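/- Let $n\in\mathbb N$, $a<b$, $\mathcal J=\begin{pmatrix}0&I\\-I&0\end{pmatrix}\in\mathbb R^{2n\times 2n}$, $E=\begin{pmatrix}0\\I\end{pmatrix}\in\mathbb R^{2n\times n}$. For $Y=\begin{pmatrix}X\\U\end{pmatrix}$, $\hat Y=\begin{pmatrix}\hat X\\ \hat U\end{pmatrix}\in\mathbb R^{2n\times n}$ with $Y^T\mathcal JY=\hat Y^T\mathcal J\hat Y=0$ and $\operatorname{rank}Y=\operatorname{rank}\hat Y=n$, put $W(Y,\hat Y)=Y^T\mathcal J\hat Y$, $\mathcal M=(I-X^\dagger X)W(Y,\hat Y)$, $V=I-\mathcal M^\dagger\mathcal M$, $\mathcal P=V\,W(Y,\hat Y)^TX^\dagger\hat X\,V$, where $\dagger$ is the Moore--Penrose pseudoinverse, and define the comparative index and the dual comparative index by $$\mu(Y,\hat Y)=\operatorname{rank}\mathcal M+\operatorname{ind}\mathcal P,\qquad \mu^*(Y,\hat Y)=\operatorname{rank}\mathcal M+\operatorname{ind}(-\mathcal P),$$ where $\operatorname{ind}$ is the number of negative eigenvalues (with multiplicity). Let $Y:[a,b]\to\mathbb R^{2n\times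 n}$ be a continuous Lagrangian path, i.e. $Y$ is continuous, $Y(t)^T\mathcal JY(t)=0$ and $\operatorname{rank}Y(t)=n$ for all $t\in[a,b]$. Call $(D,R)$ admissible for $Y$ if $D=\{a=t_0<t_1<\dots<t_p=b\}$ and $R=\{R_k\}_{k=0}^{p-1}$ are real symplectic $2n\times2n$ matrix functions on $[a,b]$ such that, for each $k$, $R_k$ is continuous on $[t_k,t_{k+1}]$ and both the rank of the upper $n\times n$ block of $R_k(t)^{-1}Y(t)$ (equivalently, $\operatorname{rank}W(R_k(t)E,Y(t))$) and the rank of the upper $n\times n$ block of $R_k(t)E$ are constant on $[t_k,t_{k+1}]$. For admissible $(D,R)$ put $$\mathcal N(Y,D,R)=\sum_{k=0}^{p-1}\big(\mu(Y(t_{k+1}),R_k(t_{k+1})E)-\mu(Y(t_k),R_k(t_k)E)\big),$$ $$\mathcal N^*(Y,D,R)=\sum_{k=0}^{p-1}\big(\mu^*(Y(t_k),R_k(t_k)E)-\mu^*(Y(t_{k+1}),R_k(t_{k+1})E)\big).$$ Let $Z_Y(t)=\big(\mathcal JY(t)K_Y(t)\;\;Y(t)K_Y(t)\big)$ with $K_Y(t)=(Y(t)^TY(t))^{-1/2}$,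 let $S_{11}(t),S_{12}(t)$ be the upper left and upper right $n\times n$ blocks of $Z_Y(t)$, and let $W(t)=(S_{11}(t)-iS_{12}(t))^{-1}(S_{11}(t)+iS_{12}(t))$. Continuous branches of the Lidskii angles of $Y$ are continuous functions $\varphi_1,\dots,\varphi_n:[a,b]\to\mathbb R$ such that, for every $t\in[a,b]$, the numbers $e^{i\varphi_1(t)},\dots,e^{i\varphi_n(t)}$ are the eigenvalues of $W(t)$, listed with multiplicity. Then admissible pairs $(D,R)$ exist and the integers $\mathcal N(Y,D,R)$ and $\mathcal N^*(Y,D,R)$ are the same for all of them; their common values are the oscillation number $\mathcal N(Y,[a,b])$ and the dual oscillation number $\mathcal N^*(Y,[a,b])$ of $Y$. Moreover, continuous branches of the Lidskii angles of $Y$ exist, and for every choice $\varphi_1,\dots,\varphi_n$ of them, with $q_j(t)=\lfloor\varphi_j(t)/2\pi\rfloor$ and $q_j^*(t)=\lceil\varphi_j(t)/2\pi\rceil-1$, $$\mathcal N(Y,[a,b])=\sum_{j=1}^n\big(q_j(b)-q_j(a)\big),\qquad \mathcal N^*(Y,[a,b])=\sum_{j=1}^n\big(q_j^*(b)-q_j^*(a)\big).$$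 -/

import Mathlib

open scoped Matrix MatrixOrder

noncomputable section

namespace LagrangianPath

/-! ### Moore-Penrose pseudoinverse and index of a real matrix -/

/-- `B` satisfies the four Penrose equations for `A`. -/
def IsMoorePenrose {m n : Type*} [Fintype m] [Fintype n]
    (A : Matrix m n ℝ) (B : Matrix n m ℝ) : Prop :=
  A * B * A = A ∧ B * A * B = B ∧ (A * B)ᵀ = A * B ∧ (B * A)ᵀ = B * A

theorem exists_isMoorePenrose {m n : Type*} [Fintype m] [Fintype n]
    (A : Matrix m n ℝ) : ∃ B : Matrix n m ℝ, IsMoorePenrose A B := by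
  classical
  have hH : (Aᵀ * A).IsHermitian := by
    simpa [Matrix.conjTranspose_eq_transpose_of_trivial] using
      Matrix.isHermitian_conjTranspose_mul_self A
  obtain ⟨U, hU⟩ : ∃ U : Matrix n n ℝ, U = (hH.eigenvectorUnitary : Matrix n n ℝ) := ⟨_, rfl⟩
  have hUU : Uᵀ * U = 1 := by
    have h := Matrix.UnitaryGroup.star_mul_self hH.eigenvectorUnitary
    rw [← hU, Matrix.star_eq_conjTranspose,
      Matrix.conjTranspose_eq_transpose_of_trivial] at h
    exact h
  obtain ⟨d, hd⟩ : ∃ d : n → ℝ, Aᵀ * A = U * Matrix.diagonal d * Uᵀ := by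
    refine ⟨hH.eigenvalues, ?_⟩
    have h := hH.spectral_theorem
    rw [Unitary.conjStarAlgAut_apply] at h
    rw [← hU, Matrix.star_eq_conjTranspose,
      Matrix.conjTranspose_eq_transpose_of_trivial] at h
    simpa [Function.comp_def] using h
  have hconj : ∀ e f : n → ℝ, (U * Matrix.diagonal e * Uᵀ) * (U * Matrix.diagonal f * Uᵀ)
      = U * Matrix.diagonal (fun i => e i * f i) * Uᵀ := by
    intro e f
    calc (U * Matrix.diagonal e * Uᵀ) * (U * Matrix.diagonal f * Uᵀ)
        = U * Matrix.diagonal e * (Uᵀ * U) * Matrix.diagonal f * Uᵀ := by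
          simp only [Matrix.mul_assoc]
      _ = U * (Matrix.diagonal e * Matrix.diagonal f) * Uᵀ := by
          rw [hUU]; simp only [Matrix.mul_assoc, Matrix.mul_one]
      _ = _ := by rw [Matrix.diagonal_mul_diagonal]
  have hsymm : ∀ e : n → ℝ, (U * Matrix.diagonal e * Uᵀ)ᵀ = U * Matrix.diagonal e * Uᵀ := by
    intro e
    simp [Matrix.transpose_mul, Matrix.mul_assoc]
  obtain ⟨G, hG⟩ : ∃ G, G = U * Matrix.diagonal (fun i => (d i)⁻¹) * Uᵀ := ⟨_, rfl⟩
  obtain ⟨H, hHdef⟩ : ∃ H, H = Aᵀ * A := ⟨_, rfl⟩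
  have hHd : H = U * Matrix.diagonal d * Uᵀ := hHdef.trans hd
  have hGt : Gᵀ = G := by rw [hG, hsymm]
  have hHt : Hᵀ = H := by rw [hHd, hsymm]
  have hGHt : (G * H)ᵀ = G * H := by rw [hG, hHd, hconj, hsymm]
  have hHGH : H * (G * H) = H := by
    rw [hG, hHd, hconj, hconj]
    congr 3
    funext i
    by_cases h : d i = 0 <;> simp [h]
  have hGHG : G * H * G = G := by
    rw [hG, hHd, hconj, hconj]
    congr 3
    funext i
    by_cases h : d i = 0 <;> simp [h]
  have hA : A * (G * H) = A := by
    have h0 : A * (1 - G * H) = 0 := by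
      rw [← Matrix.conjTranspose_mul_self_eq_zero,
        Matrix.conjTranspose_eq_transpose_of_trivial, Matrix.transpose_mul]
      calc (1 - G * H)ᵀ * Aᵀ * (A * (1 - G * H))
          = (1 - G * H)ᵀ * (H * (1 - G * H)) := by
            rw [hHdef]; simp only [Matrix.mul_assoc]
        _ = 0 := by rw [Matrix.mul_sub, hHGH]; simp
    rw [Matrix.mul_sub, Matrix.mul_one, sub_eq_zero] at h0
    exact h0.symm
  refine ⟨G * Aᵀ, ?_, ?_, ?_, ?_⟩
  · calc A * (G * Aᵀ) * A = A * (G * H) := by rw [hHdef]; simp only [Matrix.mul_assoc]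
      _ = A := hA
  · calc G * Aᵀ * A * (G * Aᵀ) = G * H * G * Aᵀ := by
          rw [hHdef]; simp only [Matrix.mul_assoc]
      _ = G * Aᵀ := by rw [hGHG]
  · simp [Matrix.transpose_mul, hGt, Matrix.mul_assoc]
  · rw [Matrix.mul_assoc, ← hHdef, hGHt]

theorem IsMoorePenrose.unique {m n : Type*} [Fintype m] [Fintype n]
    {A : Matrix m n ℝ} {B C : Matrix n m ℝ}
    (hB : IsMoorePenrose A B) (hC : IsMoorePenrose A C) : B = C := by
  obtain ⟨b1, b2, b3, b4⟩ := hB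
  obtain ⟨c1, c2, c3, c4⟩ := hC
  have h1 : A * B = A * C := by
    calc A * B = (A * B)ᵀ := b3.symm
      _ = ((A * C * A) * B)ᵀ := by rw [c1]
      _ = ((A * C) * (A * B))ᵀ := by simp only [Matrix.mul_assoc]
      _ = (A * B) * (A * C) := by rw [Matrix.transpose_mul, b3, c3]
      _ = (A * B * A) * C := by simp only [Matrix.mul_assoc]
      _ = A * C := by rw [b1]
  have h2 : B * A = C * A := by
    calc B * A = (B * A)ᵀ := b4.symm
      _ = (B * (A * C * A))ᵀ := by rw [c1]
      _ = ((B * A) * (C * A))ᵀ := by simp only [Matrix.mul_assoc]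
      _ = (C * A) * (B * A) := by rw [Matrix.transpose_mul, b4, c4]
      _ = C * (A * B * A) := by simp only [Matrix.mul_assoc]
      _ = C * A := by rw [b1]
  calc B = B * A * B := b2.symm
    _ = C * A * B := by rw [h2]
    _ = C * (A * B) := by rw [Matrix.mul_assoc]
    _ = C * A * C := by rw [h1, Matrix.mul_assoc]
    _ = C := c2

/-- The Moore-Penrose pseudoinverse `A†`. -/
def pinv {m n : Type*} [Fintype m] [Fintype n] (A : Matrix m n ℝ) : Matrix n m ℝ :=
  (exists_isMoorePenrose A).choose

theorem pinv_spec {m n : Type*} [Fintype m] [Fintype n] (A : Matrix m n ℝ) :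
    IsMoorePenrose A (pinv A) :=
  (exists_isMoorePenrose A).choose_spec

/-- The index of a (symmetric) real matrix: the number of its negative eigenvalues, counted with
multiplicity. -/
def ind {n : ℕ} (P : Matrix (Fin n) (Fin n) ℝ) : ℕ :=
  P.charpoly.roots.countP (· < 0)

/-! ### Lagrangian planes and paths, comparative index -/

/-- The canonical skew-symmetric matrix `[0 I; -I 0]` (this is `-Matrix.J`, hence it defines the
same symplectic group). -/
def J (n : ℕ) : Matrix (Fin n ⊕ Fin n) (Fin n ⊕ Fin n) ℝ :=
  Matrix.fromBlocks 0 1 (-1) 0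

/-- The vertical Lagrangian plane `(0 I)ᵀ`. -/
def E (n : ℕ) : Matrix (Fin n ⊕ Fin n) (Fin n) ℝ :=
  Matrix.fromRows 0 1

/-- The upper block `X` of `Y = (Xᵀ, Uᵀ)ᵀ`, that is, `(I 0) Y`. -/
def upper {n : ℕ} (Y : Matrix (Fin n ⊕ Fin n) (Fin n) ℝ) : Matrix (Fin n) (Fin n) ℝ :=
  Y.toRows₁

/-- The Wronskian `W(Y, Y') = Yᵀ J Y'`. -/
def wronskian {n : ℕ} (Y Y' : Matrix (Fin n ⊕ Fin n) (Fin n) ℝ) : Matrix (Fin n) (Fin n) ℝ :=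
  Yᵀ * J n * Y'

/-- `Y` is a Lagrangian plane: `Yᵀ J Y = 0` and `rank Y = n`. -/
def IsLagrangian {n : ℕ} (Y : Matrix (Fin n ⊕ Fin n) (Fin n) ℝ) : Prop :=
  Yᵀ * J n * Y = 0 ∧ Y.rank = n

/-- `Y` is a continuous Lagrangian path on `[a, b]`. -/
def IsLagrangianPath {n : ℕ} (a b : ℝ) (Y : ℝ → Matrix (Fin n ⊕ Fin n) (Fin n) ℝ) : Prop :=
  ContinuousOn Y (Set.Icc a b) ∧ ∀ t ∈ Set.Icc a b, IsLagrangian (Y t)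

/-- `M = (I - X† X) W(Y, Y')`. -/
def matM {n : ℕ} (Y Y' : Matrix (Fin n ⊕ Fin n) (Fin n) ℝ) : Matrix (Fin n) (Fin n) ℝ :=
  (1 - pinv (upper Y) * upper Y) * wronskian Y Y'

/-- `V = I - M† M`. -/
def matV {n : ℕ} (Y Y' : Matrix (Fin n ⊕ Fin n) (Fin n) ℝ) : Matrix (Fin n) (Fin n) ℝ :=
  1 - pinv (matM Y Y') * matM Y Y'

/-- `P = V W(Y, Y')ᵀ X† X' V`. -/
def matP {n : ℕ} (Y Y' : Matrix (Fin n ⊕ Fin n) (Fin n) ℝ) : Matrix (Fin n) (Fin n) ℝ :=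
  matV Y Y' * (wronskian Y Y')ᵀ * pinv (upper Y) * upper Y' * matV Y Y'

/-- The comparative index `μ(Y, Y') = rank M + ind P`. -/
def compIndex {n : ℕ} (Y Y' : Matrix (Fin n ⊕ Fin n) (Fin n) ℝ) : ℕ :=
  (matM Y Y').rank + ind (matP Y Y')

/-- The dual comparative index `μ*(Y, Y') = rank M + ind (-P)`. -/
def dualCompIndex {n : ℕ} (Y Y' : Matrix (Fin n ⊕ Fin n) (Fin n) ℝ) : ℕ :=
  (matM Y Y').rank + ind (-matP Y Y')

/-! ### Oscillation numbers -/

/-- A partition `a = t₀ < t₁ < ⋯ < t_p = b` of `[a, b]` with a system `R₀, …, R_{p-1}` of symplectic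
matrices, `R_k` continuous on `[t_k, t_{k+1}]`, such that for each `k` the rank of the upper block
of `R_k⁻¹ Y` (which equals the rank of `W(R_k E, Y)`, see `upper_inv_mul` below) and the rank of the
upper block of `R_k E` are constant on `[t_k, t_{k+1}]`. -/
structure TransSystem {n : ℕ} (a b : ℝ) (Y : ℝ → Matrix (Fin n ⊕ Fin n) (Fin n) ℝ) where
  p : ℕ
  t : Fin (p + 1) → ℝ
  R : Fin p → ℝ → Matrix (Fin n ⊕ Fin n) (Fin n ⊕ Fin n) ℝ
  strictMono : StrictMono t
  first : t 0 = a
  last : t (Fin.last p) = b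
  symplectic : ∀ k, ∀ s ∈ Set.Icc a b, R k s ∈ Matrix.symplecticGroup (Fin n) ℝ
  continuousOn : ∀ k, ContinuousOn (R k) (Set.Icc (t k.castSucc) (t k.succ))
  rank_transformed : ∀ k, ∃ r : ℕ, ∀ s ∈ Set.Icc (t k.castSucc) (t k.succ),
    (upper ((R k s)⁻¹ * Y s)).rank = r
  rank_reference : ∀ k, ∃ r : ℕ, ∀ s ∈ Set.Icc (t k.castSucc) (t k.succ),
    (upper (R k s * E n)).rank = r

theorem upper_inv_mul {n : ℕ} {R : Matrix (Fin n ⊕ Fin n) (Fin n ⊕ Fin n) ℝ}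
    (hR : R ∈ Matrix.symplecticGroup (Fin n) ℝ) (Y : Matrix (Fin n ⊕ Fin n) (Fin n) ℝ) :
    upper (R⁻¹ * Y) = -wronskian (R * E n) Y := by
  have hJ : Matrix.J (Fin n) ℝ = -J n := by
    simp [Matrix.J, J, Matrix.fromBlocks_neg]
  have h2 : ∀ M : Matrix (Fin n ⊕ Fin n) (Fin n) ℝ, upper (J n * M) = (E n)ᵀ * M := by
    intro M
    have h := Matrix.fromRows_toRows M
    rw [← h, J, Matrix.fromBlocks_mul_fromRows, E, Matrix.transpose_fromRows,
      Matrix.fromCols_mul_fromRows, upper, Matrix.toRows₁_fromRows]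
    simp
  have h3 : R⁻¹ * Y = J n * (-(Rᵀ * (J n * Y))) := by
    rw [SymplecticGroup.inv_eq_symplectic_inv R hR, hJ, neg_neg]
    simp only [Matrix.mul_neg, Matrix.neg_mul, Matrix.mul_assoc]
  rw [h3, h2]
  simp only [wronskian, Matrix.transpose_mul, Matrix.mul_assoc, Matrix.mul_neg]

/-- `N(Y, D, R) = ∑ₖ (μ(Y(t_{k+1}), R_k(t_{k+1}) E) - μ(Y(t_k), R_k(t_k) E))`. -/
def TransSystem.oscSum {n : ℕ} {a b : ℝ} {Y : ℝ → Matrix (Fin n ⊕ Fin n) (Fin n) ℝ}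
    (T : TransSystem a b Y) : ℤ :=
  ∑ k : Fin T.p,
    ((compIndex (Y (T.t k.succ)) (T.R k (T.t k.succ) * E n) : ℤ)
      - (compIndex (Y (T.t k.castSucc)) (T.R k (T.t k.castSucc) * E n) : ℤ))

/-- `N*(Y, D, R) = ∑ₖ (μ*(Y(t_k), R_k(t_k) E) - μ*(Y(t_{k+1}), R_k(t_{k+1}) E))`. -/
def TransSystem.dualOscSum {n : ℕ} {a b : ℝ} {Y : ℝ → Matrix (Fin n ⊕ Fin n) (Fin n) ℝ}
    (T : TransSystem a b Y) : ℤ :=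
  ∑ k : Fin T.p,
    ((dualCompIndex (Y (T.t k.castSucc)) (T.R k (T.t k.castSucc) * E n) : ℤ)
      - (dualCompIndex (Y (T.t k.succ)) (T.R k (T.t k.succ) * E n) : ℤ))

open Classical in
/-- The oscillation number `N(Y, [a, b])`: the value of `N(Y, D, R)` for some admissible `(D, R)`. -/
def oscNumber {n : ℕ} (a b : ℝ) (Y : ℝ → Matrix (Fin n ⊕ Fin n) (Fin n) ℝ) : ℤ :=
  if h : Nonempty (TransSystem a b Y) then h.some.oscSum else 0

open Classical in
/-- The dual oscillation number `N*(Y, [a, b])`: the value of `N*(Y, D, R)` for some admissible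
`(D, R)`. -/
def dualOscNumber {n : ℕ} (a b : ℝ) (Y : ℝ → Matrix (Fin n ⊕ Fin n) (Fin n) ℝ) : ℤ :=
  if h : Nonempty (TransSystem a b Y) then h.some.dualOscSum else 0

/-! ### Lidskii angles -/

/-- `K_Y = (Yᵀ Y)^{-1/2}`. -/
def matK {n : ℕ} (Y : Matrix (Fin n ⊕ Fin n) (Fin n) ℝ) : Matrix (Fin n) (Fin n) ℝ :=
  (CFC.sqrt (Yᵀ * Y))⁻¹

/-- `Z_Y = (J Y K_Y   Y K_Y)`. -/
def matZ {n : ℕ} (Y : Matrix (Fin n ⊕ Fin n) (Fin n) ℝ) :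
    Matrix (Fin n ⊕ Fin n) (Fin n ⊕ Fin n) ℝ :=
  Matrix.fromCols (J n * Y * matK Y) (Y * matK Y)

/-- `W_S = (S₁₁ - i S₁₂)⁻¹ (S₁₁ + i S₁₂)`. -/
def lidskiiMatrix {n : ℕ} (S : Matrix (Fin n ⊕ Fin n) (Fin n ⊕ Fin n) ℝ) :
    Matrix (Fin n) (Fin n) ℂ :=
  (S.toBlocks₁₁.map Complex.ofReal - Complex.I • S.toBlocks₁₂.map Complex.ofReal)⁻¹
    * (S.toBlocks₁₁.map Complex.ofReal + Complex.I • S.toBlocks₁₂.map Complex.ofReal)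

/-- `φ₁, …, φₙ` are Lidskii angles of `S`: the numbers `exp(i φⱼ)` are the eigenvalues of `W_S`,
listed with multiplicity. -/
def IsLidskiiAngles {n : ℕ} (S : Matrix (Fin n ⊕ Fin n) (Fin n ⊕ Fin n) ℝ) (φ : Fin n → ℝ) : Prop :=
  (lidskiiMatrix S).charpoly.roots =
    Finset.univ.val.map (fun j => Complex.exp (Complex.I * (φ j : ℂ)))

/-- `φ₁, …, φₙ` are continuous branches on `[a, b]` of the Lidskii angles of `Z_Y(t)`, i.e. Lidskii
angles of the Lagrangian path `Y`. -/
def IsLidskiiBranches {n : ℕ} (a b : ℝ) (Y : ℝ → Matrix (Fin n ⊕ Fin n) (Fin n) ℝ)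
    (φ : Fin n → ℝ → ℝ) : Prop :=
  (∀ j, ContinuousOn (φ j) (Set.Icc a b)) ∧
    ∀ t ∈ Set.Icc a b, IsLidskiiAngles (matZ (Y t)) (fun j => φ j t)

end LagrangianPath

end

namespace LagrangianPath

/-! ### The index of a symmetric matrix -/

/-! The Souriau matrix `W = (U + iX)(U - iX)⁻¹` of a Lagrangian plane `Y = (X, U)` is unitary, has
the spectrum of the Lidskii matrix of `Z_Y`, and has the eigenvalue `1` with multiplicity `dim ker
X`. For two planes, `W W'⁻¹` again has the spectrum of a Souriau matrix, and there the multiplicity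
of `1` is the corank of the Wronskian (`IsLagrangian.exists_relative`).

Let `θ` be the sum of the eigenvalue angles, divided by `2π` and reduced to `[0, 1)`. The proof
rests on the identity `μ(Y, Y') = θ(W') - θ(W) + θ(W W'⁻¹)` (`compIndex_eq_angleIndex`). The right
side, `angleIndex`, is an integer because the determinants cancel. Along continuous branches `φ`,
each `θ` is a continuous function minus a sum of floors. If the ranks of `X'` and of the Wronskian
are constant, the eigenvalue `1` keeps its multiplicity in `W'` and in `W W'⁻¹`, so no angle of
these two matrices enters or leaves `2πℤ` and their floor sums are constant. Hence `angleIndex - ∑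
⌊φ_j / 2π⌋` is continuous and integer valued, so constant (`angleIndex_sub_sum_floor`). Summing over
a partition telescopes to a value that depends only on `φ` at the endpoints, which gives both
independence of `(D, R)` and the formula.

For the identity itself, suppose first that `X` is invertible. A homotopy of vertical shears reduces
to `U = 0`, `W = -1`, where both sides can be read off a diagonal form. In general `Y` is rotated by
a small `η > 0`: `angleIndex` does not change, `X` becomes invertible, and the index of the
resulting quadratic form, which has a pole at `η = 0`, is `rank M + ind P` by a dimension count.

The dual statement follows by the reflection `(X, U) ↦ (-X, U)`, which exchanges `μ` with `μ*` and
negates all angles, turning floors into negative ceilings. -/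

theorem toQuadraticForm'_apply {n : ℕ} (P : Matrix (Fin n) (Fin n) ℝ) (c : Fin n → ℝ) :
    P.toQuadraticForm' c = c ⬝ᵥ P *ᵥ c := by
  rw [Matrix.toQuadraticForm', LinearMap.BilinMap.toQuadraticMap_apply,
    Matrix.toLinearMap₂'_apply']

/-- Sylvester's law of inertia: `c ↦ B c` is an equivalence with the weighted sum of squares with
weights `d`. -/
theorem sigNeg_congruence {n : ℕ} {B : Matrix (Fin n) (Fin n) ℝ} (hB : IsUnit B.det)
    (d : Fin n → ℝ) :
    sigNeg (Bᵀ * Matrix.diagonal d * B).toQuadraticForm' = {j | d j < 0}.ncard := by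
  refine QuadraticForm.sigNeg_of_equiv_weightedSumSquares ⟨?_⟩
  refine { Matrix.toLinearEquiv' B (B.invertibleOfIsUnitDet hB) with map_app' := ?_ }
  intro c
  have h1 : (Bᵀ * Matrix.diagonal d * B).toQuadraticForm' c
      = (B *ᵥ c) ⬝ᵥ (Matrix.diagonal d *ᵥ (B *ᵥ c)) := by
    rw [toQuadraticForm'_apply, ← Matrix.mulVec_mulVec, ← Matrix.mulVec_mulVec,
      Matrix.dotProduct_mulVec, Matrix.vecMul_transpose]
  rw [h1, QuadraticMap.weightedSumSquares_apply]
  simp only [dotProduct, Matrix.mulVec_diagonal, smul_eq_mul]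
  refine Finset.sum_congr rfl fun j _ => ?_
  simp [Matrix.toLinearEquiv']
  ring

theorem exists_orthogonal_diagonalization {n : ℕ} {P : Matrix (Fin n) (Fin n) ℝ} (hP : Pᵀ = P) :
    ∃ (A : Matrix (Fin n) (Fin n) ℝ) (d : Fin n → ℝ), Aᵀ * A = 1 ∧ A * Aᵀ = 1 ∧
      P = A * Matrix.diagonal d * Aᵀ := by
  have hH : P.IsHermitian := by
    rwa [Matrix.IsHermitian, Matrix.conjTranspose_eq_transpose_of_trivial]
  have hUU : (hH.eigenvectorUnitary : Matrix (Fin n) (Fin n) ℝ)ᵀ * hH.eigenvectorUnitary = 1 := by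
    have h := Matrix.UnitaryGroup.star_mul_self hH.eigenvectorUnitary
    rwa [Matrix.star_eq_conjTranspose, Matrix.conjTranspose_eq_transpose_of_trivial] at h
  refine ⟨hH.eigenvectorUnitary, hH.eigenvalues, hUU, mul_eq_one_comm.mp hUU, ?_⟩
  have h := hH.spectral_theorem
  rw [Unitary.conjStarAlgAut_apply, Matrix.star_eq_conjTranspose,
    Matrix.conjTranspose_eq_transpose_of_trivial] at h
  simpa [Function.comp_def] using h

theorem roots_charpoly_conj_diagonal {n : ℕ} {K : Type*} [Field K] {A B : Matrix (Fin n) (Fin n) K}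
    (hA : B * A = 1) (d : Fin n → K) :
    (A * Matrix.diagonal d * B).charpoly.roots = Finset.univ.val.map d := by
  rw [Matrix.charpoly_mul_comm, ← Matrix.mul_assoc, hA, Matrix.one_mul, Matrix.charpoly_diagonal]
  have h : ∏ i, (Polynomial.X - Polynomial.C (d i))
      = ((Finset.univ.val.map d).map fun a => Polynomial.X - Polynomial.C a).prod := by
    rw [Multiset.map_map]; rfl
  rw [h, Polynomial.roots_multiset_prod_X_sub_C]

/-- Replaces the count of negative eigenvalues by the largest dimension of a negative definite
subspace, so that indices can be compared by dimension counts. -/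
theorem ind_eq_sigNeg {n : ℕ} {P : Matrix (Fin n) (Fin n) ℝ} (hP : Pᵀ = P) :
    ind P = sigNeg P.toQuadraticForm' := by
  obtain ⟨A, d, h1, h2, rfl⟩ := exists_orthogonal_diagonalization hP
  have h3 := sigNeg_congruence (B := Aᵀ) (Matrix.isUnit_det_of_left_inverse h2) d
  rw [Matrix.transpose_transpose] at h3
  rw [h3, ind, roots_charpoly_conj_diagonal h1, Multiset.countP_map, Set.ncard_eq_toFinset_card',
    Finset.card]
  congr 1
  simp

theorem ind_congruence {n : ℕ} {B : Matrix (Fin n) (Fin n) ℝ} (hB : IsUnit B.det)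
    (d : Fin n → ℝ) :
    ind (Bᵀ * Matrix.diagonal d * B) = {j | d j < 0}.ncard := by
  rw [ind_eq_sigNeg, sigNeg_congruence hB]
  simp [Matrix.transpose_mul, Matrix.mul_assoc]

theorem finrank_le_ind {n : ℕ} {P : Matrix (Fin n) (Fin n) ℝ} (hP : Pᵀ = P)
    {S : Submodule ℝ (Fin n → ℝ)} (hS : ∀ c ∈ S, c ≠ 0 → c ⬝ᵥ P *ᵥ c < 0) :
    Module.finrank ℝ S ≤ ind P := by
  rw [ind_eq_sigNeg hP]
  refine le_sigNeg_of_negDef _ fun x hx => ?_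
  have := hS x x.2 (by simpa using hx)
  simpa [QuadraticMap.restrict_apply, toQuadraticForm'_apply] using this

theorem exists_negative_subspace {n : ℕ} {P : Matrix (Fin n) (Fin n) ℝ} (hP : Pᵀ = P) :
    ∃ S : Submodule ℝ (Fin n → ℝ), Module.finrank ℝ S = ind P ∧
      ∀ c ∈ S, c ≠ 0 → c ⬝ᵥ P *ᵥ c < 0 := by
  rw [ind_eq_sigNeg hP]
  obtain ⟨S, h1, h2⟩ := exists_finrank_eq_sigNeg_and_negDef P.toQuadraticForm'
  refine ⟨S, h1, fun c hc h0 => ?_⟩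
  have := h2 ⟨c, hc⟩ (by simpa using h0)
  simpa [QuadraticMap.restrict_apply, toQuadraticForm'_apply] using this

/-! ### Lagrangian planes in block form -/

/-- The lower block `U` of `Y = (Xᵀ, Uᵀ)ᵀ`. -/
def lower {n : ℕ} (Y : Matrix (Fin n ⊕ Fin n) (Fin n) ℝ) : Matrix (Fin n) (Fin n) ℝ :=
  Y.toRows₂

@[simp]
theorem upper_fromRows {n : ℕ} (X U : Matrix (Fin n) (Fin n) ℝ) :
    upper (Matrix.fromRows X U) = X := Matrix.toRows₁_fromRows X U

@[simp]
theorem lower_fromRows {n : ℕ} (X U : Matrix (Fin n) (Fin n) ℝ) :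
    lower (Matrix.fromRows X U) = U := Matrix.toRows₂_fromRows X U

theorem fromRows_upper_lower {n : ℕ} (Y : Matrix (Fin n ⊕ Fin n) (Fin n) ℝ) :
    Matrix.fromRows (upper Y) (lower Y) = Y := Matrix.fromRows_toRows Y

theorem wronskian_eq {n : ℕ} (Y Y' : Matrix (Fin n ⊕ Fin n) (Fin n) ℝ) :
    wronskian Y Y' = (upper Y)ᵀ * lower Y' - (lower Y)ᵀ * upper Y' := by
  rw [← fromRows_upper_lower Y, ← fromRows_upper_lower Y', wronskian, J, Matrix.mul_assoc,
    Matrix.fromBlocks_mul_fromRows, Matrix.transpose_fromRows, Matrix.fromCols_mul_fromRows]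
  simp [sub_eq_add_neg]

theorem wronskian_transpose {n : ℕ} (Y Y' : Matrix (Fin n ⊕ Fin n) (Fin n) ℝ) :
    (wronskian Y Y')ᵀ = -wronskian Y' Y := by
  simp [wronskian_eq]

theorem transpose_mul_self_eq {n : ℕ} (Y : Matrix (Fin n ⊕ Fin n) (Fin n) ℝ) :
    Yᵀ * Y = (upper Y)ᵀ * upper Y + (lower Y)ᵀ * lower Y := by
  conv_lhs => rw [← fromRows_upper_lower Y]
  rw [Matrix.transpose_fromRows, Matrix.fromCols_mul_fromRows]

theorem rank_eq_iff_isUnit_det {n : ℕ} {K : Type*} [Field K] (A : Matrix (Fin n) (Fin n) K) :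
    A.rank = n ↔ IsUnit A.det := by
  rw [← Matrix.isUnit_iff_isUnit_det]
  constructor
  · intro h
    rw [← Matrix.mulVec_surjective_iff_isUnit]
    have h1 : LinearMap.range A.mulVecLin = ⊤ := by
      apply Submodule.eq_top_of_finrank_eq
      rw [Module.finrank_fin_fun]
      exact h
    exact LinearMap.range_eq_top.mp h1
  · intro h
    simpa using Matrix.rank_of_isUnit A h

theorem isLagrangian_iff {n : ℕ} {Y : Matrix (Fin n ⊕ Fin n) (Fin n) ℝ} :
    IsLagrangian Y ↔ (upper Y)ᵀ * lower Y = (lower Y)ᵀ * upper Y ∧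
      IsUnit ((upper Y)ᵀ * upper Y + (lower Y)ᵀ * lower Y).det := by
  rw [IsLagrangian, ← Matrix.rank_transpose_mul_self Y, transpose_mul_self_eq,
    rank_eq_iff_isUnit_det]
  have := wronskian_eq Y Y
  rw [wronskian] at this
  rw [this, sub_eq_zero]

/-- `U + i X`. -/
noncomputable def holo {n : ℕ} (Y : Matrix (Fin n ⊕ Fin n) (Fin n) ℝ) : Matrix (Fin n) (Fin n) ℂ :=
  (lower Y).map Complex.ofReal + Complex.I • (upper Y).map Complex.ofReal

/-- `U - i X`. -/
noncomputable def antiholo {n : ℕ} (Y : Matrix (Fin n ⊕ Fin n) (Fin n) ℝ) :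
    Matrix (Fin n) (Fin n) ℂ :=
  (lower Y).map Complex.ofReal - Complex.I • (upper Y).map Complex.ofReal

/-- The Souriau matrix `(U + i X) (U - i X)⁻¹`. -/
noncomputable def souriau {n : ℕ} (Y : Matrix (Fin n ⊕ Fin n) (Fin n) ℝ) :
    Matrix (Fin n) (Fin n) ℂ :=
  holo Y * (antiholo Y)⁻¹

theorem map_ofReal_mul {n : ℕ} (A B : Matrix (Fin n) (Fin n) ℝ) :
    (A * B).map Complex.ofReal = A.map Complex.ofReal * B.map Complex.ofReal :=
  Matrix.map_mul (f := Complex.ofRealHom)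

theorem map_ofReal_one {n : ℕ} :
    (1 : Matrix (Fin n) (Fin n) ℝ).map Complex.ofReal = 1 :=
  Matrix.map_one _ Complex.ofReal_zero Complex.ofReal_one

theorem map_ofReal_add {n : ℕ} (A B : Matrix (Fin n) (Fin n) ℝ) :
    (A + B).map Complex.ofReal = A.map Complex.ofReal + B.map Complex.ofReal :=
  Matrix.map_add _ Complex.ofReal_add _ _

theorem map_ofReal_sub {n : ℕ} (A B : Matrix (Fin n) (Fin n) ℝ) :
    (A - B).map Complex.ofReal = A.map Complex.ofReal - B.map Complex.ofReal :=
  Matrix.map_sub _ Complex.ofReal_sub _ _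

theorem map_ofReal_diagonal {n : ℕ} (d : Fin n → ℝ) :
    (Matrix.diagonal d).map Complex.ofReal = Matrix.diagonal (fun j => (d j : ℂ)) := by
  rw [Matrix.diagonal_map Complex.ofReal_zero]

theorem det_map_ofReal {n : ℕ} (A : Matrix (Fin n) (Fin n) ℝ) :
    (A.map Complex.ofReal).det = (A.det : ℂ) :=
  (RingHom.map_det Complex.ofRealHom A).symm

/-- The imaginary part of either product is `±(XᵀU - UᵀX)`, which vanishes for a Lagrangian plane.
What remains is the invertible Gram matrix `YᵀY`, so `U ± iX` are invertible. -/
theorem IsLagrangian.conj_mul {n : ℕ} {Y : Matrix (Fin n ⊕ Fin n) (Fin n) ℝ}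
    (hY : IsLagrangian Y) :
    ((lower Y)ᵀ.map Complex.ofReal + Complex.I • (upper Y)ᵀ.map Complex.ofReal) * antiholo Y
      = ((upper Y)ᵀ * upper Y + (lower Y)ᵀ * lower Y).map Complex.ofReal ∧
    ((lower Y)ᵀ.map Complex.ofReal - Complex.I • (upper Y)ᵀ.map Complex.ofReal) * holo Y
      = ((upper Y)ᵀ * upper Y + (lower Y)ᵀ * lower Y).map Complex.ofReal := by
  have h := congrArg (fun A => A.map Complex.ofReal) (isLagrangian_iff.mp hY).1
  simp only [map_ofReal_mul] at h
  constructor <;>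
  · simp only [antiholo, holo, map_ofReal_add, map_ofReal_mul, Matrix.mul_add, Matrix.add_mul,
      Matrix.mul_sub, Matrix.sub_mul, Matrix.smul_mul, Matrix.mul_smul, smul_add, smul_sub, smul_smul,
      Complex.I_mul_I, h]
    simp only [neg_smul, one_smul]
    abel

theorem IsLagrangian.isUnit_antiholo {n : ℕ} {Y : Matrix (Fin n ⊕ Fin n) (Fin n) ℝ}
    (hY : IsLagrangian Y) : IsUnit (antiholo Y).det := by
  have h := congrArg Matrix.det hY.conj_mul.1
  rw [Matrix.det_mul, det_map_ofReal] at h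
  have h2 := (isLagrangian_iff.mp hY).2
  rw [isUnit_iff_ne_zero] at h2 ⊢
  intro h0
  rw [h0, mul_zero] at h
  exact h2 (by exact_mod_cast h.symm)

theorem IsLagrangian.isUnit_holo {n : ℕ} {Y : Matrix (Fin n ⊕ Fin n) (Fin n) ℝ}
    (hY : IsLagrangian Y) : IsUnit (holo Y).det := by
  have h := congrArg Matrix.det hY.conj_mul.2
  rw [Matrix.det_mul, det_map_ofReal] at h
  have h2 := (isLagrangian_iff.mp hY).2
  rw [isUnit_iff_ne_zero] at h2 ⊢
  intro h0
  rw [h0, mul_zero] at h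
  exact h2 (by exact_mod_cast h.symm)

theorem IsLagrangian.souriau_eq_of_mul {n : ℕ} {Y : Matrix (Fin n ⊕ Fin n) (Fin n) ℝ}
    (hY : IsLagrangian Y) {W : Matrix (Fin n) (Fin n) ℂ} (h : W * antiholo Y = holo Y) :
    souriau Y = W := by
  rw [souriau, ← h, Matrix.mul_assoc, Matrix.mul_nonsing_inv _ hY.isUnit_antiholo, Matrix.mul_one]

/-- As a polynomial in `c` the determinant is not zero, since at `c = i` it is `det (i(U + iX)) ≠
0`; hence some real `c` is not a root. -/
theorem IsLagrangian.exists_transversal {n : ℕ} {Y : Matrix (Fin n ⊕ Fin n) (Fin n) ℝ}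
    (hY : IsLagrangian Y) : ∃ c : ℝ, IsUnit (c • lower Y - upper Y).det := by
  let M : Matrix (Fin n) (Fin n) (Polynomial ℝ) :=
    (Polynomial.X : Polynomial ℝ) • (lower Y).map Polynomial.C - (upper Y).map Polynomial.C
  have h0 : M.det ≠ 0 := by
    intro h0
    have h1 := RingHom.map_det (Polynomial.eval₂RingHom Complex.ofRealHom Complex.I) M
    rw [h0, map_zero] at h1
    have h2 : (Polynomial.eval₂RingHom Complex.ofRealHom Complex.I).mapMatrix M
        = Complex.I • holo Y := by
      ext i j
      simp [M, holo, mul_add, ← mul_assoc, sub_eq_add_neg]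
      exact mul_comm _ _
    rw [h2, Matrix.det_smul] at h1
    have h3 := hY.isUnit_holo.ne_zero
    simp [h3] at h1
  obtain ⟨c, hc⟩ := Polynomial.exists_eval_ne_zero_of_natDegree_lt_card M.det h0
    ((Cardinal.natCast_lt_aleph0).trans_le (Cardinal.aleph0_le_mk ℝ))
  refine ⟨c, isUnit_iff_ne_zero.mpr ?_⟩
  have h1 := RingHom.map_det (Polynomial.evalRingHom c) M
  have h2 : (Polynomial.evalRingHom c).mapMatrix M = c • lower Y - upper Y := by
    ext i j
    simp [M]
    exact mul_comm _ _
  rw [h2] at h1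
  rw [← h1]
  exact hc

/-- Simultaneous diagonal form of the two blocks of a Lagrangian plane. -/
theorem IsLagrangian.exists_diagonal_form {n : ℕ} {Y : Matrix (Fin n ⊕ Fin n) (Fin n) ℝ}
    (hY : IsLagrangian Y) :
    ∃ (A B : Matrix (Fin n) (Fin n) ℝ) (x u : Fin n → ℝ), Aᵀ * A = 1 ∧ A * Aᵀ = 1 ∧
      IsUnit B.det ∧ (∀ j, x j ^ 2 + u j ^ 2 = 1) ∧
      upper Y = A * Matrix.diagonal x * B ∧ lower Y = A * Matrix.diagonal u * B := by
  obtain ⟨c, hc⟩ := hY.exists_transversal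
  obtain ⟨T, hT⟩ : ∃ T, T = c • lower Y - upper Y := ⟨_, rfl⟩
  rw [← hT] at hc
  have hTinv : T⁻¹ * T = 1 := Matrix.nonsing_inv_mul _ hc
  have hsymm : Tᵀ * lower Y = (lower Y)ᵀ * T := by
    rw [hT]
    simp [Matrix.sub_mul, Matrix.mul_sub, (isLagrangian_iff.mp hY).1]
  -- With `T = cU - X`, the matrix `Q = U T⁻¹` is symmetric and `X = (cQ - 1) T`. Diagonalizing `Q`
  -- therefore diagonalizes both blocks at once.
  have hQ : (lower Y * T⁻¹)ᵀ = lower Y * T⁻¹ := by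
    have h1 : T⁻¹ᵀ * Tᵀ = 1 := by
      rw [← Matrix.transpose_mul, Matrix.mul_nonsing_inv _ hc, Matrix.transpose_one]
    calc (lower Y * T⁻¹)ᵀ = T⁻¹ᵀ * ((lower Y)ᵀ * T) * T⁻¹ := by
          rw [Matrix.transpose_mul]
          simp only [Matrix.mul_assoc]
          rw [Matrix.mul_nonsing_inv _ hc, Matrix.mul_one]
      _ = (T⁻¹ᵀ * Tᵀ) * (lower Y * T⁻¹) := by rw [← hsymm]; simp only [Matrix.mul_assoc]
      _ = _ := by rw [h1, Matrix.one_mul]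
  obtain ⟨A, d, h1, h2, h3⟩ := exists_orthogonal_diagonalization hQ
  have hU : lower Y = A * Matrix.diagonal d * (Aᵀ * T) := by
    rw [← Matrix.mul_assoc, ← h3, Matrix.mul_assoc, hTinv, Matrix.mul_one]
  have hX : upper Y = A * Matrix.diagonal (fun j => c * d j - 1) * (Aᵀ * T) := by
    have e1 : Matrix.diagonal (fun j => c * d j - 1) = c • Matrix.diagonal d - 1 := by
      rw [← Matrix.diagonal_one, ← Matrix.diagonal_smul, ← Matrix.diagonal_sub]
      rfl
    rw [e1, Matrix.mul_sub, Matrix.sub_mul, Matrix.mul_one, Matrix.mul_smul, Matrix.smul_mul,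
      ← hU, ← Matrix.mul_assoc, h2, Matrix.one_mul, hT]
    abel
  -- The numbers `c d_j - 1` and `d_j` never vanish together, so each pair can be scaled to length
  -- one, the factor going into `B`.
  have hpos : ∀ j, 0 < (c * d j - 1) ^ 2 + d j ^ 2 := by
    intro j
    by_cases h : d j = 0
    · simp [h]
    · positivity
  obtain ⟨r, hr⟩ : ∃ r : Fin n → ℝ, r = fun j => √((c * d j - 1) ^ 2 + d j ^ 2) := ⟨_, rfl⟩
  have hr0 : ∀ j, r j ≠ 0 := fun j => by rw [hr]; exact (Real.sqrt_pos.mpr (hpos j)).ne'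
  have hr2 : ∀ j, r j ^ 2 = (c * d j - 1) ^ 2 + d j ^ 2 := fun j => by
    rw [hr]; exact Real.sq_sqrt (hpos j).le
  have key : ∀ e : Fin n → ℝ, A * Matrix.diagonal e * (Aᵀ * T)
      = A * Matrix.diagonal (fun j => e j / r j) * (Matrix.diagonal r * (Aᵀ * T)) := by
    intro e
    have h4 : e = fun j => e j / r j * r j := funext fun j => (div_mul_cancel₀ _ (hr0 j)).symm
    rw [← Matrix.mul_assoc _ (Matrix.diagonal r), Matrix.mul_assoc A _ (Matrix.diagonal r),
      Matrix.diagonal_mul_diagonal, ← h4]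
  refine ⟨A, Matrix.diagonal r * (Aᵀ * T), fun j => (c * d j - 1) / r j, fun j => d j / r j,
    h1, h2, ?_, ?_, hX.trans (key _), hU.trans (key _)⟩
  · rw [Matrix.det_mul, Matrix.det_mul, Matrix.det_diagonal]
    refine IsUnit.mul ?_ ((Matrix.isUnit_det_of_left_inverse h2).mul hc)
    exact isUnit_iff_ne_zero.mpr (Finset.prod_ne_zero_iff.mpr fun j _ => hr0 j)
  · intro j
    rw [div_pow, div_pow, ← add_div, ← hr2, div_self (pow_ne_zero 2 (hr0 j))]

/-! ### The spectrum of the Souriau matrix -/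

theorem holo_of_diagonal_form {n : ℕ} {Y : Matrix (Fin n ⊕ Fin n) (Fin n) ℝ}
    {A B : Matrix (Fin n) (Fin n) ℝ} {x u : Fin n → ℝ}
    (hX : upper Y = A * Matrix.diagonal x * B) (hU : lower Y = A * Matrix.diagonal u * B) :
    holo Y = A.map Complex.ofReal * Matrix.diagonal (fun j => (u j + Complex.I * x j : ℂ))
      * B.map Complex.ofReal ∧
    antiholo Y = A.map Complex.ofReal * Matrix.diagonal (fun j => (u j - Complex.I * x j : ℂ))
      * B.map Complex.ofReal := by
  have e1 : Matrix.diagonal (fun j => (u j + Complex.I * x j : ℂ))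
      = Matrix.diagonal (fun j => (u j : ℂ)) + Complex.I • Matrix.diagonal (fun j => (x j : ℂ)) := by
    rw [← Matrix.diagonal_smul, ← Matrix.diagonal_add]; rfl
  have e2 : Matrix.diagonal (fun j => (u j - Complex.I * x j : ℂ))
      = Matrix.diagonal (fun j => (u j : ℂ)) - Complex.I • Matrix.diagonal (fun j => (x j : ℂ)) := by
    rw [← Matrix.diagonal_smul, ← Matrix.diagonal_sub]; rfl
  rw [holo, antiholo, hX, hU, e1, e2]
  simp only [map_ofReal_mul, map_ofReal_diagonal, Matrix.mul_add, Matrix.add_mul, Matrix.mul_sub,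
    Matrix.sub_mul, Matrix.mul_smul, Matrix.smul_mul, and_self]

/-- When `x² + u² = 1`, the quotient `(u + ix)/(u - ix)` equals `(u + ix)²`. -/
theorem IsLagrangian.souriau_eq {n : ℕ} {Y : Matrix (Fin n ⊕ Fin n) (Fin n) ℝ}
    (hY : IsLagrangian Y) {A B : Matrix (Fin n) (Fin n) ℝ} {x u : Fin n → ℝ}
    (hA : Aᵀ * A = 1) (hxu : ∀ j, x j ^ 2 + u j ^ 2 = 1)
    (hX : upper Y = A * Matrix.diagonal x * B) (hU : lower Y = A * Matrix.diagonal u * B) :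
    souriau Y = A.map Complex.ofReal
      * Matrix.diagonal (fun j => (u j + Complex.I * x j : ℂ) ^ 2) * Aᵀ.map Complex.ofReal := by
  obtain ⟨h1, h2⟩ := holo_of_diagonal_form hX hU
  refine hY.souriau_eq_of_mul ?_
  have h3 : Aᵀ.map Complex.ofReal * A.map Complex.ofReal = 1 := by
    rw [← map_ofReal_mul, hA, map_ofReal_one]
  have h4 : (Matrix.diagonal (fun j => (u j + Complex.I * x j : ℂ) ^ 2))
      * Matrix.diagonal (fun j => (u j - Complex.I * x j : ℂ))
      = Matrix.diagonal (fun j => (u j + Complex.I * x j : ℂ)) := by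
    rw [Matrix.diagonal_mul_diagonal]
    congr 1
    funext j
    have h5 : (x j : ℂ) ^ 2 + (u j : ℂ) ^ 2 = 1 := by exact_mod_cast hxu j
    linear_combination (u j + Complex.I * x j : ℂ) * h5
      - (u j + Complex.I * x j : ℂ) * (x j : ℂ) ^ 2 * Complex.I_sq
  rw [h1, h2, ← h4]
  simp only [Matrix.mul_assoc]
  rw [← Matrix.mul_assoc (Aᵀ.map _), h3, Matrix.one_mul]

theorem IsLagrangian.roots_souriau {n : ℕ} {Y : Matrix (Fin n ⊕ Fin n) (Fin n) ℝ}
    (hY : IsLagrangian Y) {A B : Matrix (Fin n) (Fin n) ℝ} {x u : Fin n → ℝ}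
    (hA : Aᵀ * A = 1) (hxu : ∀ j, x j ^ 2 + u j ^ 2 = 1)
    (hX : upper Y = A * Matrix.diagonal x * B) (hU : lower Y = A * Matrix.diagonal u * B) :
    (souriau Y).charpoly.roots
      = Finset.univ.val.map (fun j => (u j + Complex.I * x j : ℂ) ^ 2) := by
  rw [hY.souriau_eq hA hxu hX hU]
  exact roots_charpoly_conj_diagonal (by rw [← map_ofReal_mul, hA, map_ofReal_one]) _

theorem norm_sq_of_unit {x u : ℝ} (h : x ^ 2 + u ^ 2 = 1) :
    ‖(u + Complex.I * x : ℂ) ^ 2‖ = 1 := by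
  rw [norm_pow, ← Complex.normSq_eq_norm_sq, Complex.normSq_apply]
  simp
  linarith

theorem sq_eq_one_iff_of_unit {x u : ℝ} (h : x ^ 2 + u ^ 2 = 1) :
    (u + Complex.I * x : ℂ) ^ 2 = 1 ↔ x = 0 := by
  constructor
  · intro h1
    have := congrArg Complex.re h1
    simp [sq] at this
    nlinarith
  · rintro rfl
    have : u ^ 2 = 1 := by simpa using h
    simp only [Complex.ofReal_zero, mul_zero, add_zero]
    exact_mod_cast this

theorem IsLagrangian.norm_of_mem_roots {n : ℕ} {Y : Matrix (Fin n ⊕ Fin n) (Fin n) ℝ}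
    (hY : IsLagrangian Y) : ∀ z ∈ (souriau Y).charpoly.roots, ‖z‖ = 1 := by
  obtain ⟨A, B, x, u, h1, h2, h3, h4, h5, h6⟩ := hY.exists_diagonal_form
  rw [hY.roots_souriau h1 h4 h5 h6]
  intro z hz
  obtain ⟨j, -, rfl⟩ := Multiset.mem_map.mp hz
  exact norm_sq_of_unit (h4 j)

/-- In the diagonal form, `(u_j + i x_j)² = 1` exactly when `x_j = 0`, and the rank of `X` is the
number of nonzero `x_j`. -/
theorem IsLagrangian.count_one_roots {n : ℕ} {Y : Matrix (Fin n ⊕ Fin n) (Fin n) ℝ}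
    (hY : IsLagrangian Y) :
    (souriau Y).charpoly.roots.count 1 + (upper Y).rank = n := by
  classical
  obtain ⟨A, B, x, u, h1, h2, h3, h4, h5, h6⟩ := hY.exists_diagonal_form
  rw [hY.roots_souriau h1 h4 h5 h6, h5, Matrix.rank_mul_eq_left_of_isUnit_det _ _ h3,
    Matrix.rank_mul_eq_right_of_isUnit_det _ _ (Matrix.isUnit_det_of_left_inverse h1),
    Matrix.rank_diagonal, Multiset.count_map, Fintype.card_subtype]
  have e1 : (Multiset.filter (fun j => 1 = (u j + Complex.I * x j : ℂ) ^ 2)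
      (Finset.univ : Finset (Fin n)).val).card = (Finset.univ.filter fun j => x j = 0).card := by
    rw [Finset.card]
    congr 1
    refine Multiset.filter_congr fun j _ => ?_
    rw [eq_comm, sq_eq_one_iff_of_unit (h4 j)]
  rw [e1, Finset.card_filter_add_card_filter_not, Finset.card_univ, Fintype.card_fin]

/-- The plane `Y` seen from a second Lagrangian plane `Y'`: it is Lagrangian, the rank of its upper
block is that of the Wronskian, and its Souriau matrix is similar to the quotient of the Souriau
matrices of `Y` and `Y'`. -/
theorem IsLagrangian.exists_relative {n : ℕ} {Y Y' : Matrix (Fin n ⊕ Fin n) (Fin n) ℝ}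
    (hY : IsLagrangian Y) (hY' : IsLagrangian Y') :
    ∃ Z : Matrix (Fin n ⊕ Fin n) (Fin n) ℝ, IsLagrangian Z ∧
      (upper Z).rank = (wronskian Y Y').rank ∧
      (souriau Z).charpoly = (souriau Y * (souriau Y')⁻¹).charpoly := by
  obtain ⟨A, B, x, u, h1, h2, h3, h4, h5, h6⟩ := hY'.exists_diagonal_form
  obtain ⟨Dx, hDx⟩ : ∃ D, D = Matrix.diagonal x := ⟨_, rfl⟩
  obtain ⟨Du, hDu⟩ : ∃ D, D = Matrix.diagonal u := ⟨_, rfl⟩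
  have tx : Dxᵀ = Dx := by rw [hDx, Matrix.diagonal_transpose]
  have tu : Duᵀ = Du := by rw [hDu, Matrix.diagonal_transpose]
  have hcomm : Dx * Du = Du * Dx := by
    rw [hDx, hDu, Matrix.diagonal_mul_diagonal, Matrix.diagonal_mul_diagonal]
    simp only [mul_comm]
  have hone : Dx * Dx + Du * Du = 1 := by
    rw [hDx, hDu, Matrix.diagonal_mul_diagonal, Matrix.diagonal_mul_diagonal, Matrix.diagonal_add,
      ← Matrix.diagonal_one]
    congr 1
    funext j
    simpa [sq] using h4 j
  rw [← hDx] at h5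
  rw [← hDu] at h6
  obtain ⟨P, hP⟩ : ∃ P, P = Aᵀ * upper Y := ⟨_, rfl⟩
  obtain ⟨Q, hQ⟩ : ∃ Q, Q = Aᵀ * lower Y := ⟨_, rfl⟩
  have hYs := isLagrangian_iff.mp hY
  have cancel : ∀ M : Matrix (Fin n) (Fin n) ℝ, A * (Aᵀ * M) = M := fun M => by
    rw [← Matrix.mul_assoc, h2, Matrix.one_mul]
  have hPQ : Pᵀ * Q = Qᵀ * P := by
    rw [hP, hQ]
    simp only [Matrix.transpose_mul, Matrix.transpose_transpose, Matrix.mul_assoc, cancel]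
    exact hYs.1
  have hPP : Pᵀ * P + Qᵀ * Q = (upper Y)ᵀ * upper Y + (lower Y)ᵀ * lower Y := by
    rw [hP, hQ]
    simp only [Matrix.transpose_mul, Matrix.transpose_transpose, Matrix.mul_assoc, cancel]
  have ins : ∀ M N : Matrix (Fin n) (Fin n) ℝ, Mᵀ * N
      = Mᵀ * (Dx * (Dx * N)) + Mᵀ * (Du * (Du * N)) := fun M N => by
    rw [← Matrix.mul_add, ← Matrix.mul_assoc, ← Matrix.mul_assoc, ← Matrix.add_mul, hone,
      Matrix.one_mul]
  have hcomm' : ∀ M : Matrix (Fin n) (Fin n) ℝ, Dx * (Du * M) = Du * (Dx * M) := fun M => by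
    rw [← Matrix.mul_assoc, hcomm, Matrix.mul_assoc]
  -- After the orthogonal change of coordinates `Aᵀ`, rotate the `j`-th coordinate plane by the
  -- angle with cosine `u_j` and sine `x_j`. The same map sends `Y'` to the vertical plane `(0, B)`.
  let Z := Matrix.fromRows (Du * P - Dx * Q) (Du * Q + Dx * P)
  have hZ : IsLagrangian Z := by
    rw [isLagrangian_iff]
    simp only [Z, upper_fromRows, lower_fromRows, Matrix.transpose_sub, Matrix.transpose_add,
      Matrix.transpose_mul, tx, tu, Matrix.mul_sub, Matrix.sub_mul, Matrix.mul_add, Matrix.add_mul,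
      Matrix.mul_assoc, hcomm']
    constructor
    · have h7 := hPQ
      rw [ins P Q, ins Q P] at h7
      rw [← sub_eq_zero] at h7 ⊢
      rw [← h7]
      abel
    · have h7 := hPP
      rw [ins P P, ins Q Q] at h7
      have h8 := hYs.2
      rw [← h7] at h8
      convert h8 using 2
      abel
  refine ⟨Z, hZ, ?_, ?_⟩
  · have h7 : (wronskian Y Y')ᵀ = Bᵀ * upper Z := by
      rw [wronskian_eq, h5, h6]
      simp only [Z, upper_fromRows, Matrix.transpose_sub, Matrix.transpose_mul, tx, tu, hP, hQ,
        Matrix.transpose_transpose, Matrix.mul_sub, Matrix.mul_assoc]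
    rw [← Matrix.rank_transpose (wronskian Y Y'), h7,
      Matrix.rank_mul_eq_right_of_isUnit_det _ _ (by rwa [Matrix.det_transpose])]
  · obtain ⟨e, he⟩ : ∃ e : Matrix (Fin n) (Fin n) ℂ,
      e = Du.map Complex.ofReal - Complex.I • Dx.map Complex.ofReal := ⟨_, rfl⟩
    obtain ⟨f, hf⟩ : ∃ f : Matrix (Fin n) (Fin n) ℂ,
      f = Du.map Complex.ofReal + Complex.I • Dx.map Complex.ofReal := ⟨_, rfl⟩
    have hcC := congrArg (fun A => A.map Complex.ofReal) hcomm
    have hoC := congrArg (fun A => A.map Complex.ofReal) hone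
    simp only [map_ofReal_mul, map_ofReal_add, map_ofReal_one] at hcC hoC
    have hef : e * f = 1 := by
      rw [he, hf, ← hoC]
      simp only [Matrix.mul_add, Matrix.sub_mul, Matrix.smul_mul, Matrix.mul_smul,
        smul_smul, Complex.I_mul_I, hcC, smul_sub]
      simp only [neg_smul, one_smul]
      abel
    have hfe : f * e = 1 := mul_eq_one_comm.mp hef
    have hholo : holo Z = e * (Aᵀ.map Complex.ofReal * holo Y) := by
      simp only [holo, Z, upper_fromRows, lower_fromRows, he, hP, hQ, map_ofReal_add,
        map_ofReal_sub, map_ofReal_mul, Matrix.mul_add, Matrix.sub_mul, Matrix.smul_mul,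
        Matrix.mul_smul, smul_smul, smul_sub, Complex.I_mul_I]
      simp only [neg_smul, one_smul]
      abel
    have hanti : antiholo Z = f * (Aᵀ.map Complex.ofReal * antiholo Y) := by
      simp only [antiholo, Z, upper_fromRows, lower_fromRows, hf, hP, hQ, map_ofReal_add,
        map_ofReal_sub, map_ofReal_mul, Matrix.mul_sub, Matrix.add_mul, Matrix.smul_mul,
        Matrix.mul_smul, smul_smul, smul_add, smul_sub, Complex.I_mul_I]
      simp only [neg_smul, one_smul]
      abel
    have hAA : A.map Complex.ofReal * Aᵀ.map Complex.ofReal = 1 := by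
      rw [← map_ofReal_mul, h2, map_ofReal_one]
    have hAA' : Aᵀ.map Complex.ofReal * A.map Complex.ofReal = 1 := by
      rw [← map_ofReal_mul, h1, map_ofReal_one]
    have hsZ : souriau Z = e * Aᵀ.map Complex.ofReal * souriau Y * (A.map Complex.ofReal * e) := by
      refine hZ.souriau_eq_of_mul ?_
      rw [hanti, hholo, souriau]
      calc _ = e * Aᵀ.map Complex.ofReal * (holo Y * (antiholo Y)⁻¹)
            * (A.map Complex.ofReal * (e * f) * Aᵀ.map Complex.ofReal) * antiholo Y := by
            simp only [Matrix.mul_assoc]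
        _ = _ := by
            rw [hef, Matrix.mul_one, hAA, Matrix.mul_one]
            simp only [Matrix.mul_assoc]
            rw [Matrix.nonsing_inv_mul _ hY.isUnit_antiholo, Matrix.mul_one]
    have hsY' : (souriau Y')⁻¹ = A.map Complex.ofReal * e * (e * Aᵀ.map Complex.ofReal) := by
      apply Matrix.inv_eq_left_inv
      have : souriau Y' = A.map Complex.ofReal * f * (f * Aᵀ.map Complex.ofReal) := by
        rw [hY'.souriau_eq h1 h4 (hDx ▸ h5) (hDu ▸ h6)]
        have : Matrix.diagonal (fun j => (u j + Complex.I * x j : ℂ) ^ 2) = f * f := by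
          rw [hf, hDx, hDu, map_ofReal_diagonal, map_ofReal_diagonal, ← Matrix.diagonal_smul,
            Matrix.diagonal_add, Matrix.diagonal_mul_diagonal]
          simp [sq]
        rw [this]
        simp only [Matrix.mul_assoc]
      rw [this]
      calc _ = A.map Complex.ofReal * (e * (e * (Aᵀ.map Complex.ofReal * A.map Complex.ofReal) * f)
            * f) * Aᵀ.map Complex.ofReal := by simp only [Matrix.mul_assoc]
        _ = _ := by rw [hAA', Matrix.mul_one, hef, Matrix.mul_one, hef, Matrix.mul_one, hAA]
    -- `souriau Z = (e Aᵀ) W (A e)` and `W'⁻¹ = (A e)(e Aᵀ)`, so `W W'⁻¹` arises from `souriau Z` by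
    -- a cyclic permutation of factors.
    rw [hsZ, hsY', Matrix.mul_assoc (e * _), Matrix.charpoly_mul_comm]
    simp only [Matrix.mul_assoc]

/-- The Lidskii matrix of `Z_Y` has the spectrum of the Souriau matrix of `Y`. -/
theorem IsLagrangian.charpoly_lidskiiMatrix {n : ℕ} {Y : Matrix (Fin n ⊕ Fin n) (Fin n) ℝ}
    (hY : IsLagrangian Y) : (lidskiiMatrix (matZ Y)).charpoly = (souriau Y).charpoly := by
  have hK : IsUnit (matK Y).det := by
    rw [matK, Matrix.isUnit_nonsing_inv_det_iff]
    have h0 : 0 ≤ Yᵀ * Y := by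
      rw [← Matrix.conjTranspose_eq_transpose_of_trivial]
      exact (Matrix.posSemidef_conjTranspose_mul_self Y).nonneg
    have h1 := congrArg Matrix.det (CFC.sqrt_mul_sqrt_self (Yᵀ * Y) h0)
    rw [transpose_mul_self_eq, Matrix.det_mul] at h1
    have h2 := (isLagrangian_iff.mp hY).2
    rw [← h1] at h2
    rw [transpose_mul_self_eq]
    exact isUnit_of_mul_isUnit_left h2
  have hJ : J n * Y = Matrix.fromRows (lower Y) (-upper Y) := by
    conv_lhs => rw [← fromRows_upper_lower Y]
    rw [J, Matrix.fromBlocks_mul_fromRows]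
    simp
  have e1 : (matZ Y).toBlocks₁₁ = lower Y * matK Y := by
    rw [matZ, hJ]
    ext i j
    simp [Matrix.toBlocks₁₁, Matrix.fromCols, Matrix.mul_apply]
  have e2 : (matZ Y).toBlocks₁₂ = upper Y * matK Y := by
    rw [matZ]
    ext i j
    simp [Matrix.toBlocks₁₂, Matrix.fromCols, Matrix.mul_apply, upper]
  have hK' : IsUnit ((matK Y).map Complex.ofReal).det := by
    rw [det_map_ofReal]
    exact hK.map Complex.ofRealHom
  have e3 : lidskiiMatrix (matZ Y) = (antiholo Y * (matK Y).map Complex.ofReal)⁻¹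
      * (holo Y * (matK Y).map Complex.ofReal) := by
    rw [lidskiiMatrix, e1, e2, antiholo, holo, Matrix.sub_mul, Matrix.add_mul, map_ofReal_mul,
      map_ofReal_mul, Matrix.smul_mul]
  -- Swapping the two factors makes the normalization `K_Y` cancel; only the spectrum, not the
  -- matrix, is preserved.
  rw [e3, Matrix.charpoly_mul_comm, Matrix.mul_inv_rev, souriau]
  rw [Matrix.mul_assoc, ← Matrix.mul_assoc _ _ ((antiholo Y)⁻¹), Matrix.mul_nonsing_inv _ hK',
    Matrix.one_mul]

/-! ### Continuous branches of the eigenvalue angles -/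

/-- Corresponding fibres of `f` and `g` have the same cardinality; bijections between them assemble
to a permutation. -/
theorem exists_perm_of_map_univ_eq {n : ℕ} {α : Type*} {f g : Fin n → α}
    (h : (Finset.univ : Finset (Fin n)).val.map f = Finset.univ.val.map g) :
    ∃ σ : Equiv.Perm (Fin n), ∀ j, g (σ j) = f j := by
  classical
  have hcard : ∀ c, Fintype.card {j // f j = c} = Fintype.card {j // g j = c} := by
    intro c
    have h1 := congrArg (Multiset.count c) h
    rw [Multiset.count_map, Multiset.count_map] at h1
    rw [Fintype.card_subtype, Fintype.card_subtype, Finset.card, Finset.card]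
    simpa [eq_comm] using h1
  exact ⟨Equiv.ofFiberEquiv fun c => Fintype.equivOfCardEq (hcard c),
    fun j => Equiv.ofFiberEquiv_map _ j⟩

theorem exists_tuple_of_card {n : ℕ} {α : Type*} {m : Multiset α} (h : m.card = n) :
    ∃ f : Fin n → α, m = Finset.univ.val.map f := by
  subst h
  obtain ⟨l, rfl⟩ := Quotient.exists_rep m
  refine ⟨fun j => l.get j, ?_⟩
  rw [Fin.univ_val_map]
  exact congrArg _ (List.ofFn_get l).symm

theorem map_univ_comp_perm {n : ℕ} {α : Type*} (f : Fin n → α) (σ : Equiv.Perm (Fin n)) :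
    (Finset.univ : Finset (Fin n)).val.map (fun j => f (σ j)) = Finset.univ.val.map f := by
  conv_rhs => rw [← Multiset.map_univ_val_equiv σ, Multiset.map_map]
  rfl

theorem exp_I_mul_eq_iff {s t : ℝ} :
    Complex.exp (Complex.I * s) = Complex.exp (Complex.I * t) ↔
      ∃ k : ℤ, s = t + k * (2 * Real.pi) := by
  rw [Complex.exp_eq_exp_iff_exists_int]
  refine exists_congr fun k => ⟨fun h => ?_, fun h => ?_⟩
  · have h1 : Complex.I * ((s : ℂ) - (t + k * (2 * Real.pi))) = 0 := by linear_combination h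
    have h2 := (mul_eq_zero.mp h1).resolve_left Complex.I_ne_zero
    exact_mod_cast sub_eq_zero.mp h2
  · rw [h]
    push_cast
    ring

theorem eq_of_exp_I_mul_eq {c s t : ℝ} (hs : s ∈ Set.Ioo c (c + 2 * Real.pi))
    (ht : t ∈ Set.Ioo c (c + 2 * Real.pi))
    (h : Complex.exp (Complex.I * s) = Complex.exp (Complex.I * t)) : s = t := by
  obtain ⟨k, hk⟩ := exp_I_mul_eq_iff.mp h
  have hpi := Real.two_pi_pos
  have h1 : (k : ℝ) < 1 := by
    by_contra! h1
    nlinarith [hs.1, hs.2, ht.1, ht.2]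
  have h2 : (-1 : ℝ) < k := by
    by_contra! h2
    nlinarith [hs.1, hs.2, ht.1, ht.2]
  have h3 : k = 0 := by
    have h1' : k < 1 := by exact_mod_cast h1
    have h2' : -1 < k := by exact_mod_cast h2
    omega
  simpa [h3] using hk

theorem exists_angle {z : ℂ} (hz : ‖z‖ = 1) (c : ℝ) :
    ∃ θ ∈ Set.Ico c (c + 2 * Real.pi), z = Complex.exp (Complex.I * θ) := by
  refine ⟨toIcoMod Real.two_pi_pos c z.arg, toIcoMod_mem_Ico _ _ _, ?_⟩
  have h1 : z = Complex.exp (Complex.I * z.arg) := by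
    conv_lhs => rw [← Complex.norm_mul_exp_arg_mul_I z, hz]
    simp [mul_comm]
  conv_lhs => rw [h1]
  rw [exp_I_mul_eq_iff]
  refine ⟨toIcoDiv Real.two_pi_pos c z.arg, ?_⟩
  have := toIcoMod_add_toIcoDiv_zsmul Real.two_pi_pos c z.arg
  rw [zsmul_eq_mul] at this
  exact this.symm

/-- Nondecreasing tuples in an interval of length less than `2π` depend continuously on the
polynomials whose roots they parametrize. -/
theorem isEmbedding_monotone_angles {n : ℕ} {c c₁ c₂ : ℝ} (h₁ : c < c₁)
    (h₂ : c₂ < c + 2 * Real.pi) :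
    Topology.IsEmbedding (fun (x : {x : Fin n → ℝ | Monotone x ∧ ∀ j, x j ∈ Set.Icc c₁ c₂}) (z : ℂ) =>
      ∏ j, (z - Complex.exp (Complex.I * (x.1 j : ℂ)))) := by
  have hcl : IsClosed {x : Fin n → ℝ | Monotone x ∧ ∀ j, x j ∈ Set.Icc c₁ c₂} := by
    have : {x : Fin n → ℝ | Monotone x ∧ ∀ j, x j ∈ Set.Icc c₁ c₂}
        = {x : Fin n → ℝ | Monotone x} ∩ Set.pi Set.univ fun _ => Set.Icc c₁ c₂ := by
      ext x
      simp only [Set.mem_inter_iff, Set.mem_ofPred_eq, Set.mem_pi, Set.mem_univ, true_implies]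
    rw [this]
    exact isClosed_monotone.inter (isClosed_set_pi fun _ _ => isClosed_Icc)
  have hcp : IsCompact {x : Fin n → ℝ | Monotone x ∧ ∀ j, x j ∈ Set.Icc c₁ c₂} := by
    refine (isCompact_univ_pi fun _ : Fin n => isCompact_Icc (a := c₁) (b := c₂)).of_isClosed_subset
      hcl fun x hx => ?_
    exact fun j _ => hx.2 j
  have : CompactSpace {x : Fin n → ℝ | Monotone x ∧ ∀ j, x j ∈ Set.Icc c₁ c₂} :=
    isCompact_iff_compactSpace.mp hcp
  -- The domain is compact, so continuity and injectivity suffice.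
  refine (Continuous.isClosedEmbedding ?_ ?_).isEmbedding
  · refine continuous_pi fun z => continuous_finsetProd _ fun j _ => ?_
    have : Continuous fun x : {x : Fin n → ℝ | Monotone x ∧ ∀ j, x j ∈ Set.Icc c₁ c₂} => x.1 j :=
      (continuous_apply j).comp continuous_subtype_val
    exact continuous_const.sub (Complex.continuous_exp.comp
      (continuous_const.mul (Complex.continuous_ofReal.comp this)))
  -- The values determine the polynomial, hence the multiset of roots; on an interval shorter than
  -- `2π` they determine the angles up to order, and the order is fixed by monotonicity.
  · intro x y hxy
    have hp : ∏ j, (Polynomial.X - Polynomial.C (Complex.exp (Complex.I * (x.1 j : ℂ))))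
        = ∏ j, (Polynomial.X - Polynomial.C (Complex.exp (Complex.I * (y.1 j : ℂ)))) := by
      refine Polynomial.funext fun z => ?_
      simpa [Polynomial.eval_prod] using congrFun hxy z
    rw [← Matrix.charpoly_diagonal, ← Matrix.charpoly_diagonal] at hp
    have hroots := fun d : Fin n → ℂ => roots_charpoly_conj_diagonal
      (A := (1 : Matrix (Fin n) (Fin n) ℂ)) (B := 1) (Matrix.one_mul 1) d
    simp only [Matrix.one_mul, Matrix.mul_one] at hroots
    have hm := congrArg Polynomial.roots hp
    rw [hroots, hroots] at hm
    obtain ⟨σ, hσ⟩ := exists_perm_of_map_univ_eq hm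
    have hI : ∀ w : {x : Fin n → ℝ | Monotone x ∧ ∀ j, x j ∈ Set.Icc c₁ c₂}, ∀ j,
        w.1 j ∈ Set.Ioo c (c + 2 * Real.pi) := fun w j =>
      ⟨h₁.trans_le (w.2.2 j).1, (w.2.2 j).2.trans_lt h₂⟩
    have hσ' : x.1 = y.1 ∘ σ := funext fun j =>
      (eq_of_exp_I_mul_eq (hI y _) (hI x _) (hσ j)).symm
    refine Subtype.ext ?_
    have := Tuple.unique_monotone (f := y.1) (σ := σ) (τ := Equiv.refl _) (hσ' ▸ x.2.1) y.2.1
    rw [hσ', this]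
    rfl

theorem card_roots_charpoly {n : ℕ} (A : Matrix (Fin n) (Fin n) ℂ) :
    A.charpoly.roots.card = n := by
  rw [← (IsAlgClosed.splits A.charpoly).natDegree_eq_card_roots, Matrix.charpoly_natDegree_eq_dim,
    Fintype.card_fin]

theorem eval_charpoly_eq_prod {n : ℕ} {A : Matrix (Fin n) (Fin n) ℂ} {f : Fin n → ℂ}
    (h : A.charpoly.roots = Finset.univ.val.map f) (z : ℂ) :
    A.charpoly.eval z = ∏ j, (z - f j) := by
  rw [(IsAlgClosed.splits A.charpoly).eval_eq_prod_roots, h, (A.charpoly_monic).leadingCoeff,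
    one_mul, Multiset.map_map]
  rfl

theorem exists_monotone_angles {n : ℕ} {A : Matrix (Fin n) (Fin n) ℂ} {c₁ c₂ : ℝ}
    (h : ∀ z ∈ A.charpoly.roots, ∃ θ ∈ Set.Icc c₁ c₂, z = Complex.exp (Complex.I * (θ : ℂ))) :
    ∃ x : Fin n → ℝ, (Monotone x ∧ ∀ j, x j ∈ Set.Icc c₁ c₂) ∧
      A.charpoly.roots = Finset.univ.val.map fun j => Complex.exp (Complex.I * (x j : ℂ)) := by
  obtain ⟨f, hf⟩ := exists_tuple_of_card (card_roots_charpoly A)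
  have h1 : ∀ j, ∃ θ ∈ Set.Icc c₁ c₂, f j = Complex.exp (Complex.I * (θ : ℂ)) := fun j =>
    h _ (by rw [hf]; exact Multiset.mem_map_of_mem _ (Finset.mem_univ j))
  choose θ hθ hfθ using h1
  refine ⟨θ ∘ Tuple.sort θ, ⟨Tuple.monotone_sort θ, fun j => hθ _⟩, ?_⟩
  rw [hf, ← map_univ_comp_perm f (Tuple.sort θ)]
  exact Multiset.map_congr rfl fun j _ => hfθ _

/-- Continuous branches on `[u, v]` of the angles of the eigenvalues of `A`. -/
def HasBranches {n : ℕ} (A : ℝ → Matrix (Fin n) (Fin n) ℂ) (φ : Fin n → ℝ → ℝ) (u v : ℝ) : Prop :=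
  (∀ j, ContinuousOn (φ j) (Set.Icc u v)) ∧ ∀ t ∈ Set.Icc u v, (A t).charpoly.roots =
    Finset.univ.val.map fun j => Complex.exp (Complex.I * (φ j t : ℂ))

theorem exists_notMem_angle {m : Multiset ℂ} : ∃ c : ℝ, Complex.exp (Complex.I * (c : ℂ)) ∉ m := by
  by_contra! h
  have h1 : Set.InjOn (fun c : ℝ => Complex.exp (Complex.I * (c : ℂ))) (Set.Ioo 0 (0 + 2 * Real.pi)) :=
    fun s hs t ht hst => eq_of_exp_I_mul_eq hs ht hst
  have h2 : Set.Finite {z | z ∈ m} := by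
    classical
    exact (m.toFinset.finite_toSet).subset fun z hz => by simpa using hz
  exact (Set.Ioo_infinite (by simpa using Real.two_pi_pos))
    (Set.Finite.of_finite_image (h2.subset (by rintro _ ⟨c, -, rfl⟩; exact h c)) h1)

/-- A direction `e^{ic}` outside the spectrum at `t₀` stays outside the spectrum nearby. Cutting the
circle there, the sorted angles are well defined, and they are continuous because the characteristic
polynomial is. -/
theorem exists_local_branches {n : ℕ} {a b : ℝ} {A : ℝ → Matrix (Fin n) (Fin n) ℂ}
    (hA : ContinuousOn A (Set.Icc a b))
    (hnorm : ∀ t ∈ Set.Icc a b, ∀ z ∈ (A t).charpoly.roots, ‖z‖ = 1)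
    {t₀ : ℝ} (ht₀ : t₀ ∈ Set.Icc a b) :
    ∃ ε > 0, ∀ u ∈ Set.Icc a b, ∀ v ∈ Set.Icc a b, u ≤ v → |u - t₀| < ε → |v - t₀| < ε →
      ∃ φ, HasBranches A φ u v := by
  obtain ⟨c, hc⟩ := exists_notMem_angle (m := (A t₀).charpoly.roots)
  have heval : ∀ z, ContinuousOn (fun t => (A t).charpoly.eval z) (Set.Icc a b) := by
    intro z
    simp only [Matrix.eval_charpoly]
    have h4 : Continuous fun M : Matrix (Fin n) (Fin n) ℂ => M.det := continuous_id.matrix_det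
    exact h4.comp_continuousOn (continuousOn_const.sub hA)
  obtain ⟨F, hFdef⟩ : ∃ F : ℝ × ℝ → ℂ, F = fun p : ℝ × ℝ =>
      (A p.1).charpoly.eval (Complex.exp (Complex.I * (p.2 : ℂ))) := ⟨_, rfl⟩
  have hF : ContinuousOn F (Set.Icc a b ×ˢ Set.univ) := by
    simp only [hFdef, Matrix.eval_charpoly]
    have h1 : ContinuousOn (fun p : ℝ × ℝ => A p.1) (Set.Icc a b ×ˢ Set.univ) :=
      hA.comp continuousOn_fst fun p hp => hp.1
    have h3 : Continuous fun p : ℝ × ℝ => Matrix.scalar (Fin n) (Complex.exp (Complex.I * (p.2 : ℂ))) := by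
      simp only [Matrix.scalar_apply]
      refine Continuous.matrix_diagonal (continuous_pi fun _ => ?_)
      fun_prop
    have h4 : Continuous fun M : Matrix (Fin n) (Fin n) ℂ => M.det := continuous_id.matrix_det
    exact h4.comp_continuousOn (h3.continuousOn.sub h1)
  have hroot : ∀ t ψ : ℝ, Complex.exp (Complex.I * (ψ : ℂ)) ∈ (A t).charpoly.roots ↔ F (t, ψ) = 0 := by
    intro t ψ
    rw [Polynomial.mem_roots (A t).charpoly_monic.ne_zero, Polynomial.IsRoot.def, hFdef]
  have hne : F (t₀, c) ≠ 0 := fun h0 => hc ((hroot t₀ c).mpr h0)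
  have hev := (hF (t₀, c) ⟨ht₀, Set.mem_univ _⟩).eventually_ne hne
  rw [eventually_nhdsWithin_iff, Metric.eventually_nhds_iff] at hev
  obtain ⟨δ, hδ, hev⟩ := hev
  have hev' : ∀ t ∈ Set.Icc a b, |t - t₀| < δ → ∀ ψ : ℝ, |ψ - c| < δ →
      Complex.exp (Complex.I * (ψ : ℂ)) ∉ (A t).charpoly.roots := by
    intro t ht htδ ψ hψ hmem
    refine hev (y := (t, ψ)) ?_ ⟨ht, Set.mem_univ _⟩ ((hroot t ψ).mp hmem)
    rw [Prod.dist_eq, Real.dist_eq, Real.dist_eq]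
    exact max_lt htδ hψ
  have hang : ∀ t ∈ Set.Icc a b, |t - t₀| < δ → ∀ z ∈ (A t).charpoly.roots,
      ∃ θ ∈ Set.Icc (c + δ / 2) (c + 2 * Real.pi - δ / 2), z = Complex.exp (Complex.I * (θ : ℂ)) := by
    intro t ht htδ z hz
    obtain ⟨θ, hθ, rfl⟩ := exists_angle (hnorm t ht z hz) c
    refine ⟨θ, ⟨?_, ?_⟩, rfl⟩
    · by_contra! hlt
      exact hev' t ht htδ θ (abs_lt.mpr ⟨by linarith [hθ.1], by linarith⟩) hz
    -- An angle just below `c + 2π` is, after subtracting `2π`, close to the forbidden direction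
    -- `c`.
    · by_contra! hlt
      refine hev' t ht htδ (θ - 2 * Real.pi)
        (abs_lt.mpr ⟨by linarith, by linarith [hθ.2]⟩) ?_
      rwa [exp_I_mul_eq_iff.mpr ⟨-1, by push_cast; ring⟩]
  refine ⟨δ, hδ, fun u hu v hv huv huδ hvδ => ?_⟩
  have hsub : ∀ t ∈ Set.Icc u v, t ∈ Set.Icc a b ∧ |t - t₀| < δ := fun t ht =>
    ⟨⟨hu.1.trans ht.1, ht.2.trans hv.2⟩, abs_lt.mpr ⟨by linarith [(abs_lt.mp huδ).1, ht.1],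
      by linarith [(abs_lt.mp hvδ).2, ht.2]⟩⟩
  have hx : ∀ t : Set.Icc u v, ∃ x : Fin n → ℝ,
      (Monotone x ∧ ∀ j, x j ∈ Set.Icc (c + δ / 2) (c + 2 * Real.pi - δ / 2)) ∧
      (A t).charpoly.roots = Finset.univ.val.map fun j => Complex.exp (Complex.I * (x j : ℂ)) :=
    fun t => exists_monotone_angles (hang t (hsub t t.2).1 (hsub t t.2).2)
  choose x hx1 hx2 using hx
  have hemb := isEmbedding_monotone_angles (n := n) (c := c) (c₁ := c + δ / 2)
    (c₂ := c + 2 * Real.pi - δ / 2) (by linarith) (by linarith)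
  -- Continuity is tested after the embedding, where it is continuity of `t ↦ (A t).charpoly.eval z`
  -- for each `z`.
  have hcont : Continuous fun t : Set.Icc u v => (⟨x t, hx1 t⟩ :
      {x : Fin n → ℝ | Monotone x ∧ ∀ j, x j ∈ Set.Icc (c + δ / 2) (c + 2 * Real.pi - δ / 2)}) := by
    rw [hemb.continuous_iff]
    refine continuous_pi fun z => ?_
    have h1 := continuousOn_iff_continuous_domRestrict.mp
      ((heval z).mono fun t (ht : t ∈ Set.Icc u v) => (hsub t ht).1)
    refine h1.congr fun t => ?_
    exact eval_charpoly_eq_prod (hx2 t) z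
  refine ⟨fun j t => if ht : t ∈ Set.Icc u v then x ⟨t, ht⟩ j else 0, fun j => ?_, fun t ht => ?_⟩
  · rw [continuousOn_iff_continuous_domRestrict]
    refine ((continuous_apply j).comp (continuous_subtype_val.comp hcont)).congr fun t => ?_
    simp only [Set.domRestrict_apply, t.2, dite_true]
    rfl
  · simp only [ht, dite_true]
    exact hx2 ⟨t, ht⟩

/-- At `v` the two families list the same eigenvalues, so they agree there after a permutation and
shifts by multiples of `2π`; the same corrections are applied to the whole right-hand family. -/
theorem HasBranches.glue {n : ℕ} {A : ℝ → Matrix (Fin n) (Fin n) ℂ} {φ ψ : Fin n → ℝ → ℝ}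
    {u v w : ℝ} (huv : u ≤ v) (hvw : v ≤ w) (hφ : HasBranches A φ u v) (hψ : HasBranches A ψ v w) :
    ∃ χ, HasBranches A χ u w := by
  have h1 := hφ.2 v ⟨huv, le_rfl⟩
  rw [hψ.2 v ⟨le_rfl, hvw⟩] at h1
  obtain ⟨σ, hσ⟩ := exists_perm_of_map_univ_eq h1.symm
  have hk := fun j => exp_I_mul_eq_iff.mp (hσ j)
  choose k hk using hk
  let χ : Fin n → ℝ → ℝ := fun j t =>
    if t ≤ v then φ j t else ψ (σ j) t - k j * (2 * Real.pi)
  have e1 : ∀ j, Set.EqOn (χ j) (φ j) (Set.Icc u v) := fun j t ht => if_pos ht.2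
  have e2 : ∀ j, Set.EqOn (χ j) (fun t => ψ (σ j) t - k j * (2 * Real.pi)) (Set.Icc v w) := by
    intro j t ht
    rcases ht.1.eq_or_lt with rfl | hlt
    · simp only [χ, le_refl, if_true, hk j]
      ring
    · exact if_neg hlt.not_ge
  have hun : Set.Icc u w = Set.Icc u v ∪ Set.Icc v w := (Set.Icc_union_Icc_eq_Icc huv hvw).symm
  refine ⟨χ, fun j => ?_, fun t ht => ?_⟩
  · rw [hun]
    exact ContinuousOn.union_of_isClosed ((hφ.1 j).congr (e1 j))
      (((hψ.1 (σ j)).sub continuousOn_const).congr (e2 j)) isClosed_Icc isClosed_Icc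
  · rw [hun] at ht
    rcases ht with ht | ht
    · rw [hφ.2 t ht]
      exact Multiset.map_congr rfl fun j _ => by rw [e1 j ht]
    · rw [hψ.2 t ht, ← map_univ_comp_perm _ σ]
      refine Multiset.map_congr rfl fun j _ => ?_
      rw [e2 j ht, exp_I_mul_eq_iff]
      exact ⟨k j, by ring⟩

/-- A Lebesgue number of the cover by the balls of radius `ε` bounds the step. It serves twice: for
gluing local branches and for building an admissible partition. -/
theorem exists_equipartition {a b : ℝ} (hab : a < b) {P : ℝ → ℝ → Prop}
    (h : ∀ t ∈ Set.Icc a b, ∃ ε > 0, ∀ u ∈ Set.Icc a b, ∀ v ∈ Set.Icc a b, u ≤ v →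
      |u - t| < ε → |v - t| < ε → P u v) :
    ∃ N : ℕ, 0 < N ∧
      ∀ k < N, P (a + k * ((b - a) / N)) (a + ((k + 1 : ℕ) : ℝ) * ((b - a) / N)) := by
  choose! ε hε hP using h
  obtain ⟨δ, hδ, hball⟩ := lebesgue_number_lemma_of_metric (isCompact_Icc (a := a) (b := b))
    (c := fun t : Set.Icc a b => Metric.ball (t : ℝ) (ε t)) (fun t => Metric.isOpen_ball)
    (fun t ht => Set.mem_iUnion.mpr ⟨⟨t, ht⟩, Metric.mem_ball_self (hε t ht)⟩)
  obtain ⟨N, hN⟩ := exists_nat_gt ((b - a) / δ)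
  have hba : 0 < b - a := sub_pos.mpr hab
  have hN0 : (0 : ℝ) < N := (div_pos hba hδ).trans hN
  have hstep : 0 < (b - a) / N := div_pos hba hN0
  have hlt : (b - a) / N < δ := by
    rw [div_lt_iff₀ hN0]
    rw [div_lt_iff₀ hδ] at hN
    linarith
  have hmem : ∀ k : ℕ, k ≤ N → a + k * ((b - a) / N) ∈ Set.Icc a b := by
    intro k hk
    have hk' : (k : ℝ) ≤ N := by exact_mod_cast hk
    refine ⟨by nlinarith [(Nat.cast_nonneg k : (0 : ℝ) ≤ k)], ?_⟩
    have : (N : ℝ) * ((b - a) / N) = b - a := by field_simp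
    nlinarith
  refine ⟨N, by exact_mod_cast hN0, fun k hk => ?_⟩
  obtain ⟨t, ht⟩ := hball _ (hmem k hk.le)
  have h1 := ht (Metric.mem_ball_self hδ)
  have h2 : a + ((k + 1 : ℕ) : ℝ) * ((b - a) / N) ∈ Metric.ball (a + k * ((b - a) / N)) δ := by
    rw [Metric.mem_ball, Real.dist_eq]
    push_cast
    rw [show a + ((k : ℝ) + 1) * ((b - a) / N) - (a + k * ((b - a) / N)) = (b - a) / N by ring,
      abs_of_pos hstep]
    exact hlt
  have h3 := ht h2
  rw [Metric.mem_ball, Real.dist_eq] at h1 h3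
  refine hP t t.2 _ (hmem k hk.le) _ (hmem (k + 1) hk) ?_ h1 h3
  push_cast
  nlinarith

/-- A continuous path of matrices with unimodular eigenvalues has continuous eigenvalue angles. -/
theorem exists_branches {n : ℕ} {a b : ℝ} (hab : a < b) {A : ℝ → Matrix (Fin n) (Fin n) ℂ}
    (hA : ContinuousOn A (Set.Icc a b))
    (hnorm : ∀ t ∈ Set.Icc a b, ∀ z ∈ (A t).charpoly.roots, ‖z‖ = 1) :
    ∃ φ, HasBranches A φ a b := by
  obtain ⟨N, hN, hP⟩ := exists_equipartition hab (P := fun u v => ∃ φ, HasBranches A φ u v)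
    fun t ht => exists_local_branches hA hnorm ht
  have hN0 : (0 : ℝ) < N := by exact_mod_cast hN
  have hstep : 0 < (b - a) / N := div_pos (sub_pos.mpr hab) hN0
  have key : ∀ k : ℕ, 1 ≤ k → k ≤ N → ∃ φ, HasBranches A φ a (a + (k : ℝ) * ((b - a) / N)) := by
    intro k hk
    induction k, hk using Nat.le_induction with
    | base =>
      intro h
      simpa using hP 0 hN
    | succ k hk ih =>
      intro h
      obtain ⟨φ, hφ⟩ := ih (by omega)
      obtain ⟨ψ, hψ⟩ := hP k (by omega)
      refine hφ.glue ?_ ?_ hψ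
      · nlinarith [(Nat.cast_nonneg k : (0 : ℝ) ≤ k)]
      · push_cast
        nlinarith
  have h1 := key N hN le_rfl
  rwa [show a + (N : ℝ) * ((b - a) / N) = b by field_simp; ring] at h1

theorem HasBranches.mono {n : ℕ} {A : ℝ → Matrix (Fin n) (Fin n) ℂ} {φ : Fin n → ℝ → ℝ}
    {a b u v : ℝ} (h : HasBranches A φ a b) (hau : a ≤ u) (hvb : v ≤ b) : HasBranches A φ u v :=
  ⟨fun j => (h.1 j).mono (Set.Icc_subset_Icc hau hvb),
    fun t ht => h.2 t (Set.Icc_subset_Icc hau hvb ht)⟩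

/-! ### Normalized angle sums -/

/-- The sum of the arguments, normalized to `[0, 1)`, of a multiset of complex numbers. -/
noncomputable def angleSum (m : Multiset ℂ) : ℝ :=
  (m.map fun z => Int.fract (z.arg / (2 * Real.pi))).sum

theorem fract_arg_exp (θ : ℝ) :
    Int.fract ((Complex.exp (Complex.I * (θ : ℂ))).arg / (2 * Real.pi))
      = Int.fract (θ / (2 * Real.pi)) := by
  have hpi := Real.two_pi_pos
  have h1 : Complex.exp (Complex.I * ((Complex.exp (Complex.I * (θ : ℂ))).arg : ℂ))
      = Complex.exp (Complex.I * (θ : ℂ)) := by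
    have hn : ‖Complex.exp (Complex.I * (θ : ℂ))‖ = 1 := by
      rw [mul_comm]; exact Complex.norm_exp_ofReal_mul_I θ
    have := Complex.norm_mul_exp_arg_mul_I (Complex.exp (Complex.I * (θ : ℂ)))
    rwa [hn, Complex.ofReal_one, one_mul, mul_comm] at this
  obtain ⟨k, hk⟩ := exp_I_mul_eq_iff.mp h1
  rw [Int.fract_eq_fract]
  refine ⟨k, ?_⟩
  rw [hk]
  field_simp
  ring

/-- Splits the angle sum into a part that is continuous along branches and an integer part. -/
theorem angleSum_map_exp {n : ℕ} (φ : Fin n → ℝ) :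
    angleSum (Finset.univ.val.map fun j => Complex.exp (Complex.I * (φ j : ℂ)))
      = ∑ j, φ j / (2 * Real.pi) - ((∑ j, ⌊φ j / (2 * Real.pi)⌋ : ℤ) : ℝ) := by
  rw [angleSum, Multiset.map_map]
  push_cast
  rw [← Finset.sum_sub_distrib]
  exact Finset.sum_congr rfl fun j _ => fract_arg_exp _

/-- Reducing modulo one does not affect the exponential. For a spectrum the product is the
determinant, whence the integrality of `angleIndex`. -/
theorem exp_angleSum {m : Multiset ℂ} (hm : ∀ z ∈ m, ‖z‖ = 1) :
    Complex.exp (Complex.I * ((angleSum m * (2 * Real.pi) : ℝ) : ℂ)) = m.prod := by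
  induction m using Multiset.induction_on with
  | empty => simp [angleSum]
  | cons z m ih =>
    have h1 := ih fun w hw => hm w (Multiset.mem_cons_of_mem hw)
    obtain ⟨θ, -, hθ⟩ := exists_angle (hm z (Multiset.mem_cons_self z m)) 0
    have h2 : angleSum (z ::ₘ m) = Int.fract (θ / (2 * Real.pi)) + angleSum m := by
      rw [← fract_arg_exp, ← hθ]
      simp [angleSum]
    have h3 : Complex.exp (Complex.I * ((Int.fract (θ / (2 * Real.pi)) * (2 * Real.pi) : ℝ) : ℂ))
        = z := by
      rw [hθ, exp_I_mul_eq_iff]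
      refine ⟨-⌊θ / (2 * Real.pi)⌋, ?_⟩
      rw [Int.fract]
      have hpi := Real.two_pi_pos.ne'
      push_cast
      field_simp
      ring
    rw [Multiset.prod_cons, ← h1, h2, ← h3, ← Complex.exp_add]
    congr 1
    push_cast
    ring

theorem exp_I_mul_eq_one_iff {θ : ℝ} :
    Complex.exp (Complex.I * (θ : ℂ)) = 1 ↔ Int.fract (θ / (2 * Real.pi)) = 0 := by
  have h := exp_I_mul_eq_iff (s := θ) (t := 0)
  rw [Complex.ofReal_zero, mul_zero, Complex.exp_zero] at h
  have hpi := Real.two_pi_pos.ne'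
  rw [h, Int.fract_eq_zero_iff]
  refine exists_congr fun k => ?_
  rw [eq_div_iff hpi, zero_add, eq_comm]

/-- The sum of the integer parts of the angles changes only when the number of angles that are
multiples of `2π` changes. -/
theorem sum_floor_eq {n : ℕ} {a b : ℝ} {φ : Fin n → ℝ → ℝ}
    (hφ : ∀ j, ContinuousOn (φ j) (Set.Icc a b)) {r : ℕ}
    (hr : ∀ t ∈ Set.Icc a b, (Finset.univ.val.map fun j =>
      Complex.exp (Complex.I * (φ j t : ℂ))).count 1 = r)
    {s t : ℝ} (hs : s ∈ Set.Icc a b) (ht : t ∈ Set.Icc a b) :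
    ∑ j, ⌊φ j s / (2 * Real.pi)⌋ = ∑ j, ⌊φ j t / (2 * Real.pi)⌋ := by
  refine isPreconnected_Icc.constant (f := fun t => ∑ j, ⌊φ j t / (2 * Real.pi)⌋) ?_ hs ht
  intro t₀ ht₀
  obtain ⟨ψ, hψ⟩ : ∃ ψ : Fin n → ℝ → ℝ, ψ = fun j t => φ j t / (2 * Real.pi) := ⟨_, rfl⟩
  have hψc : ∀ j, ContinuousWithinAt (ψ j) (Set.Icc a b) t₀ := fun j => by
    rw [hψ]; exact ((hφ j).div_const _) t₀ ht₀
  have hcard : ∀ t ∈ Set.Icc a b, (Finset.univ.filter fun j => Int.fract (ψ j t) = 0).card = r := by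
    intro t ht
    have e1 : (Finset.univ.filter fun j => Int.fract (ψ j t) = 0)
        = Finset.univ.filter fun j => 1 = Complex.exp (Complex.I * (φ j t : ℂ)) := by
      refine Finset.filter_congr fun j _ => ?_
      rw [eq_comm (a := (1 : ℂ)), exp_I_mul_eq_one_iff, hψ]
    rw [← hr t ht, Multiset.count_map, e1]
    rfl
  -- A non-integral value stays non-integral nearby, with the same floor.
  have hfloor : ∀ j, Int.fract (ψ j t₀) ≠ 0 →
      ∀ᶠ t in nhdsWithin t₀ (Set.Icc a b), Int.fract (ψ j t) ≠ 0 ∧ ⌊ψ j t⌋ = ⌊ψ j t₀⌋ := by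
    intro j hj
    have h1 : (⌊ψ j t₀⌋ : ℝ) < ψ j t₀ := by
      have := (Int.fract_nonneg (ψ j t₀)).lt_of_ne' hj
      rw [Int.fract] at this
      linarith
    filter_upwards [(hψc j).eventually (Ioo_mem_nhds h1 (Int.lt_floor_add_one (ψ j t₀)))] with t ht
    have h2 : ⌊ψ j t⌋ = ⌊ψ j t₀⌋ := Int.floor_eq_iff.mpr ⟨ht.1.le, ht.2⟩
    refine ⟨?_, h2⟩
    rw [Int.fract, h2]
    linarith [ht.1]
  have hev : ∀ᶠ t in nhdsWithin t₀ (Set.Icc a b), ∀ j,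
      (Int.fract (ψ j t₀) ≠ 0 → Int.fract (ψ j t) ≠ 0 ∧ ⌊ψ j t⌋ = ⌊ψ j t₀⌋) ∧
        |ψ j t - ψ j t₀| < 1 := by
    rw [Filter.eventually_all]
    intro j
    refine Filter.Eventually.and ?_ ?_
    · by_cases hj : Int.fract (ψ j t₀) = 0
      · exact Filter.Eventually.of_forall fun t h => absurd hj h
      · exact (hfloor j hj).mono fun t ht _ => ht
    · have := (hψc j).eventually (Metric.ball_mem_nhds (ψ j t₀) one_pos)
      simpa [Real.dist_eq] using this
  have hconst : ∀ᶠ t in nhdsWithin t₀ (Set.Icc a b),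
      ∑ j, ⌊φ j t / (2 * Real.pi)⌋ = ∑ j, ⌊φ j t₀ / (2 * Real.pi)⌋ := by
    filter_upwards [hev, self_mem_nhdsWithin] with t ht htI
    -- So near `t₀` the set of integral values can only shrink. Its size being constant, it stays
    -- the same, and an integer that moves by less than one does not move.
    have hsub : (Finset.univ.filter fun j => Int.fract (ψ j t) = 0)
        ⊆ Finset.univ.filter fun j => Int.fract (ψ j t₀) = 0 := by
      intro j hj
      rw [Finset.mem_filter] at hj ⊢
      refine ⟨hj.1, ?_⟩
      by_contra h
      exact ((ht j).1 h).1 hj.2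
    have heq := Finset.eq_of_subset_of_card_le hsub (by rw [hcard t htI, hcard t₀ ht₀])
    refine Finset.sum_congr rfl fun j _ => ?_
    have goal : ⌊ψ j t⌋ = ⌊ψ j t₀⌋ := by
      by_cases hj : Int.fract (ψ j t₀) = 0
      · have hj' : Int.fract (ψ j t) = 0 := by
          have : j ∈ Finset.univ.filter fun j => Int.fract (ψ j t) = 0 := by
            rw [heq]; simpa using hj
          simpa using this
        have h1 := Int.self_sub_fract (ψ j t)
        have h2 := Int.self_sub_fract (ψ j t₀)
        have h3 := (ht j).2
        rw [hj', sub_zero] at h1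
        rw [hj, sub_zero] at h2
        rw [h1, h2] at h3
        have h4 : |⌊ψ j t⌋ - ⌊ψ j t₀⌋| < 1 := by exact_mod_cast h3
        have := Int.abs_lt_one_iff.mp h4
        omega
      · exact ((ht j).1 hj).2
    rw [hψ] at goal
    exact goal
  exact (tendsto_const_nhds.congr' (hconst.mono fun t ht => ht.symm) :)

/-! ### Continuity of the Souriau matrix and the angle index -/

theorem continuousOn_holo {n : ℕ} {a b : ℝ} {Y : ℝ → Matrix (Fin n ⊕ Fin n) (Fin n) ℝ}
    (hY : ContinuousOn Y (Set.Icc a b)) :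
    ContinuousOn (fun t => holo (Y t)) (Set.Icc a b) ∧
      ContinuousOn (fun t => antiholo (Y t)) (Set.Icc a b) := by
  have hl : Continuous fun M : Matrix (Fin n ⊕ Fin n) (Fin n) ℝ => (lower M).map Complex.ofReal :=
    continuous_matrix fun i j => Complex.continuous_ofReal.comp (continuous_id.matrix_elem _ _)
  have hu : Continuous fun M : Matrix (Fin n ⊕ Fin n) (Fin n) ℝ => (upper M).map Complex.ofReal :=
    continuous_matrix fun i j => Complex.continuous_ofReal.comp (continuous_id.matrix_elem _ _)
  exact ⟨(hl.add (hu.const_smul Complex.I)).comp_continuousOn hY,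
    (hl.sub (hu.const_smul Complex.I)).comp_continuousOn hY⟩

theorem continuousOn_inv {n : ℕ} {S : Set ℝ} {A : ℝ → Matrix (Fin n) (Fin n) ℂ}
    (hA : ContinuousOn A S) (h : ∀ t ∈ S, IsUnit (A t).det) :
    ContinuousOn (fun t => (A t)⁻¹) S := by
  have h1 : ContinuousOn (fun t => (A t).det) S :=
    (continuous_id.matrix_det (A := fun M : Matrix (Fin n) (Fin n) ℂ => M)).comp_continuousOn hA
  have h2 : ContinuousOn (fun t => (A t).adjugate) S :=
    (continuous_id.matrix_adjugate (A := fun M : Matrix (Fin n) (Fin n) ℂ => M)).comp_continuousOn hA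
  refine ((h1.inv₀ fun t ht => (h t ht).ne_zero).smul h2).congr fun t ht => ?_
  rw [Matrix.inv_def, Ring.inverse_eq_inv']
  rfl

theorem IsLagrangian.isUnit_souriau {n : ℕ} {Y : Matrix (Fin n ⊕ Fin n) (Fin n) ℝ}
    (hY : IsLagrangian Y) : IsUnit (souriau Y).det := by
  rw [souriau, Matrix.det_mul]
  exact hY.isUnit_holo.mul (Matrix.isUnit_nonsing_inv_det _ hY.isUnit_antiholo)

theorem IsLagrangianPath.continuousOn_souriau {n : ℕ} {a b : ℝ}
    {Y : ℝ → Matrix (Fin n ⊕ Fin n) (Fin n) ℝ} (hY : IsLagrangianPath a b Y) :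
    ContinuousOn (fun t => souriau (Y t)) (Set.Icc a b) :=
  (continuousOn_holo hY.1).1.mul
    (continuousOn_inv (continuousOn_holo hY.1).2 fun t ht => (hY.2 t ht).isUnit_antiholo)

/-- The comparative index in terms of the angles of Souriau matrices. -/
noncomputable def angleIndex {n : ℕ} (Y Y' : Matrix (Fin n ⊕ Fin n) (Fin n) ℝ) : ℝ :=
  angleSum (souriau Y').charpoly.roots - angleSum (souriau Y).charpoly.roots
    + angleSum (souriau Y * (souriau Y')⁻¹).charpoly.roots

/-- Multiplied by `2πi` and exponentiated, the angle index becomes `det W' · (det W)⁻¹ · det (W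
W'⁻¹) = 1`. -/
theorem exists_angleIndex_eq_intCast {n : ℕ} {Y Y' : Matrix (Fin n ⊕ Fin n) (Fin n) ℝ}
    (hY : IsLagrangian Y) (hY' : IsLagrangian Y') : ∃ k : ℤ, angleIndex Y Y' = k := by
  obtain ⟨Z, hZ, -, hZc⟩ := hY.exists_relative hY'
  have e1 := exp_angleSum hY.norm_of_mem_roots
  have e2 := exp_angleSum hY'.norm_of_mem_roots
  have e3 := exp_angleSum (hZc ▸ hZ.norm_of_mem_roots)
  rw [← Matrix.det_eq_prod_roots_charpoly] at e1 e2 e3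
  rw [Matrix.det_mul, Matrix.det_nonsing_inv, Ring.inverse_eq_inv'] at e3
  have h : Complex.exp (Complex.I * ((angleIndex Y Y' * (2 * Real.pi) : ℝ) : ℂ)) = 1 := by
    have h0 : Complex.I * ((angleIndex Y Y' * (2 * Real.pi) : ℝ) : ℂ)
        = Complex.I * ((angleSum (souriau Y').charpoly.roots * (2 * Real.pi) : ℝ) : ℂ)
        - Complex.I * ((angleSum (souriau Y).charpoly.roots * (2 * Real.pi) : ℝ) : ℂ)
        + Complex.I * ((angleSum (souriau Y * (souriau Y')⁻¹).charpoly.roots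
          * (2 * Real.pi) : ℝ) : ℂ) := by
      rw [angleIndex]
      push_cast
      ring
    rw [h0, Complex.exp_add, Complex.exp_sub, e1, e2, e3]
    have h1 := hY.isUnit_souriau.ne_zero
    have h2 := hY'.isUnit_souriau.ne_zero
    field_simp
  have h3 := exp_I_mul_eq_one_iff.mp h
  rw [mul_div_cancel_right₀ _ Real.two_pi_pos.ne', Int.fract_eq_zero_iff] at h3
  obtain ⟨k, hk⟩ := h3
  exact ⟨k, hk.symm⟩

theorem rank_eq_of_count {n : ℕ} {Y : Matrix (Fin n ⊕ Fin n) (Fin n) ℝ} (hY : IsLagrangian Y) :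
    (souriau Y).charpoly.roots.count 1 = n - (upper Y).rank := by
  have := hY.count_one_roots
  omega

/-- The angle index minus the sum of the integer parts of the angles is constant along a path if
the ranks of the Wronskian and of the upper block of the second plane are. -/
theorem angleIndex_sub_sum_floor {n : ℕ} {a b : ℝ} (hab : a < b)
    {Y Y' : ℝ → Matrix (Fin n ⊕ Fin n) (Fin n) ℝ}
    (hY : IsLagrangianPath a b Y) (hY' : IsLagrangianPath a b Y') {r r' : ℕ}
    (hr : ∀ t ∈ Set.Icc a b, (wronskian (Y t) (Y' t)).rank = r)
    (hr' : ∀ t ∈ Set.Icc a b, (upper (Y' t)).rank = r')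
    {φ : Fin n → ℝ → ℝ} (hφ : HasBranches (fun t => souriau (Y t)) φ a b) :
    angleIndex (Y b) (Y' b) - angleIndex (Y a) (Y' a)
      = ((∑ j, ⌊φ j b / (2 * Real.pi)⌋ - ∑ j, ⌊φ j a / (2 * Real.pi)⌋ : ℤ) : ℝ) := by
  have hcW := hY.continuousOn_souriau
  have hcW' := hY'.continuousOn_souriau
  have hrel : ∀ t ∈ Set.Icc a b, ∃ Z, IsLagrangian Z ∧
      (upper Z).rank = (wronskian (Y t) (Y' t)).rank ∧
      (souriau Z).charpoly = (souriau (Y t) * (souriau (Y' t))⁻¹).charpoly := fun t ht =>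
    (hY.2 t ht).exists_relative (hY'.2 t ht)
  have hcR : ContinuousOn (fun t => souriau (Y t) * (souriau (Y' t))⁻¹) (Set.Icc a b) :=
    hcW.mul (continuousOn_inv hcW' fun t ht => (hY'.2 t ht).isUnit_souriau)
  obtain ⟨ψ, hψ⟩ := exists_branches hab hcW' fun t ht => (hY'.2 t ht).norm_of_mem_roots
  obtain ⟨χ, hχ⟩ := exists_branches hab hcR fun t ht => by
    obtain ⟨Z, hZ, -, hZc⟩ := hrel t ht
    rw [← hZc]
    exact hZ.norm_of_mem_roots
  have ha : a ∈ Set.Icc a b := ⟨le_rfl, hab.le⟩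
  have hb : b ∈ Set.Icc a b := ⟨hab.le, le_rfl⟩
  -- Constant rank of the upper block of `Y'` means constant multiplicity of the eigenvalue `1` of
  -- `W'`; below, the rank of the Wronskian plays this role for `W W'⁻¹`.
  have hψf : ∀ t ∈ Set.Icc a b,
      ∑ j, ⌊ψ j t / (2 * Real.pi)⌋ = ∑ j, ⌊ψ j a / (2 * Real.pi)⌋ := fun t ht =>
    sum_floor_eq hψ.1 (r := n - r') (fun s hs => by
      rw [← hψ.2 s hs, rank_eq_of_count (hY'.2 s hs), hr' s hs]) ht ha
  have hχf : ∀ t ∈ Set.Icc a b,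
      ∑ j, ⌊χ j t / (2 * Real.pi)⌋ = ∑ j, ⌊χ j a / (2 * Real.pi)⌋ := fun t ht =>
    sum_floor_eq hχ.1 (r := n - r) (fun s hs => by
      obtain ⟨Z, hZ, hZr, hZc⟩ := hrel s hs
      rw [← hχ.2 s hs, ← hZc, rank_eq_of_count hZ, hZr, hr s hs]) ht ha
  -- With those two floor sums frozen at `a`, this is a continuous expression for the angle index
  -- minus the floors of `φ`.
  let g : ℝ → ℝ := fun t => ∑ j, ψ j t / (2 * Real.pi) - ∑ j, φ j t / (2 * Real.pi)
    + ∑ j, χ j t / (2 * Real.pi) - ((∑ j, ⌊ψ j a / (2 * Real.pi)⌋ : ℤ) : ℝ)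
    - ((∑ j, ⌊χ j a / (2 * Real.pi)⌋ : ℤ) : ℝ)
  have hg : ∀ t ∈ Set.Icc a b, angleIndex (Y t) (Y' t)
      - ((∑ j, ⌊φ j t / (2 * Real.pi)⌋ : ℤ) : ℝ) = g t := by
    intro t ht
    rw [angleIndex, hψ.2 t ht, hφ.2 t ht, hχ.2 t ht, angleSum_map_exp, angleSum_map_exp,
      angleSum_map_exp, hψf t ht, hχf t ht]
    simp only [g]
    ring
  have hsumc : ∀ f : Fin n → ℝ → ℝ, (∀ j, ContinuousOn (f j) (Set.Icc a b)) →
      ContinuousOn (fun t => ∑ j, f j t / (2 * Real.pi)) (Set.Icc a b) := fun f hf =>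
    continuousOn_finsetSum _ fun j _ => (hf j).div_const _
  have hgc : ContinuousOn g (Set.Icc a b) :=
    ((((hsumc ψ hψ.1).sub (hsumc φ hφ.1)).add (hsumc χ hχ.1)).sub continuousOn_const).sub
      continuousOn_const
  have hgi : Set.MapsTo g (Set.Icc a b) (Set.range ((↑) : ℤ → ℝ)) := by
    intro t ht
    rw [← hg t ht]
    obtain ⟨k, hk⟩ := exists_angleIndex_eq_intCast (hY.2 t ht) (hY'.2 t ht)
    exact ⟨k - ∑ j, ⌊φ j t / (2 * Real.pi)⌋, by rw [hk]; push_cast; rfl⟩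
  have hdisc : DiscreteTopology (Set.range ((↑) : ℤ → ℝ)) :=
    Int.isClosedEmbedding_coe_real.isEmbedding.toHomeomorph.symm.isEmbedding.discreteTopology
  have hgab : g b = g a := isPreconnected_Icc.constant_of_mapsTo ⟨hdisc⟩ hgc hgi hb ha
  have h1 := hg a ha
  have h2 := hg b hb
  push_cast at h1 h2 ⊢
  linarith

/-! ### Symplectic transformations -/

theorem matrixJ_eq (n : ℕ) : Matrix.J (Fin n) ℝ = -J n := by
  simp [Matrix.J, J, Matrix.fromBlocks_neg]

theorem wronskian_symplectic_mul {n : ℕ} {R : Matrix (Fin n ⊕ Fin n) (Fin n ⊕ Fin n) ℝ}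
    (hR : R ∈ Matrix.symplecticGroup (Fin n) ℝ) (Y Y' : Matrix (Fin n ⊕ Fin n) (Fin n) ℝ) :
    wronskian (R * Y) (R * Y') = wronskian Y Y' := by
  have h := SymplecticGroup.mem_iff'.mp hR
  rw [matrixJ_eq, Matrix.mul_neg, Matrix.neg_mul, neg_inj] at h
  calc wronskian (R * Y) (R * Y') = Yᵀ * (Rᵀ * J n * R) * Y' := by
        rw [wronskian, Matrix.transpose_mul]
        simp only [Matrix.mul_assoc]
    _ = wronskian Y Y' := by rw [h, wronskian]

theorem IsLagrangian.symplectic_mul {n : ℕ} {R : Matrix (Fin n ⊕ Fin n) (Fin n ⊕ Fin n) ℝ}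
    (hR : R ∈ Matrix.symplecticGroup (Fin n) ℝ) {Y : Matrix (Fin n ⊕ Fin n) (Fin n) ℝ}
    (hY : IsLagrangian Y) : IsLagrangian (R * Y) := by
  refine ⟨(wronskian_symplectic_mul hR Y Y).trans hY.1, ?_⟩
  rw [Matrix.rank_mul_eq_right_of_isUnit_det _ _ (SymplecticGroup.symplectic_det hR), hY.2]

theorem isLagrangian_E (n : ℕ) : IsLagrangian (E n) := by
  rw [isLagrangian_iff]
  simp [E]

/-- The vertical shear `(X, U) ↦ (X, U + Q X)`. -/
def vShear {n : ℕ} (Q : Matrix (Fin n) (Fin n) ℝ) : Matrix (Fin n ⊕ Fin n) (Fin n ⊕ Fin n) ℝ :=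
  Matrix.fromBlocks 1 0 Q 1

/-- The horizontal shear `(X, U) ↦ (X + Q U, U)`. -/
def hShear {n : ℕ} (Q : Matrix (Fin n) (Fin n) ℝ) : Matrix (Fin n ⊕ Fin n) (Fin n ⊕ Fin n) ℝ :=
  Matrix.fromBlocks 1 Q 0 1

theorem vShear_mem {n : ℕ} {Q : Matrix (Fin n) (Fin n) ℝ} (hQ : Qᵀ = Q) :
    vShear Q ∈ Matrix.symplecticGroup (Fin n) ℝ := by
  rw [SymplecticGroup.mem_iff, vShear, Matrix.J, Matrix.fromBlocks_transpose,
    Matrix.fromBlocks_multiply, Matrix.fromBlocks_multiply]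
  simp [hQ]

theorem hShear_mem {n : ℕ} {Q : Matrix (Fin n) (Fin n) ℝ} (hQ : Qᵀ = Q) :
    hShear Q ∈ Matrix.symplecticGroup (Fin n) ℝ := by
  rw [SymplecticGroup.mem_iff, hShear, Matrix.J, Matrix.fromBlocks_transpose,
    Matrix.fromBlocks_multiply, Matrix.fromBlocks_multiply]
  simp [hQ]

theorem vShear_mul {n : ℕ} (Q : Matrix (Fin n) (Fin n) ℝ)
    (Y : Matrix (Fin n ⊕ Fin n) (Fin n) ℝ) :
    vShear Q * Y = Matrix.fromRows (upper Y) (lower Y + Q * upper Y) := by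
  conv_lhs => rw [← fromRows_upper_lower Y, vShear, Matrix.fromBlocks_mul_fromRows]
  simp [add_comm]

/-! ### The angle index of a pair whose first plane has an invertible upper block -/

theorem angleSum_map_univ {n : ℕ} (f : Fin n → ℂ) :
    angleSum (Finset.univ.val.map f) = ∑ j, Int.fract ((f j).arg / (2 * Real.pi)) := by
  rw [angleSum, Multiset.map_map]
  rfl

/-- With `z = e^{2πis}`, `0 ≤ s < 1`, the left side is `s - 1/2 + fract (1/2 - s)`, which jumps from
`0` to `1` as `s` passes `1/2`, where the sine turns negative. -/
theorem angle_comparison {z : ℂ} (hz : ‖z‖ = 1) :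
    Int.fract (z.arg / (2 * Real.pi)) - Int.fract ((-1 : ℂ).arg / (2 * Real.pi))
      + Int.fract ((-z⁻¹).arg / (2 * Real.pi)) = if z.im < 0 then 1 else 0 := by
  obtain ⟨θ, hθ, rfl⟩ := exists_angle hz 0
  have hpi := Real.pi_pos
  have e1 : (-1 : ℂ) = Complex.exp (Complex.I * (Real.pi : ℂ)) := by
    rw [mul_comm, Complex.exp_pi_mul_I]
  have e2 : -(Complex.exp (Complex.I * (θ : ℂ)))⁻¹
      = Complex.exp (Complex.I * ((Real.pi - θ : ℝ) : ℂ)) := by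
    rw [← Complex.exp_neg, ← neg_one_mul, e1, ← Complex.exp_add]
    congr 1
    push_cast
    ring
  have e3 : (Complex.exp (Complex.I * (θ : ℂ))).im = Real.sin θ := by
    rw [mul_comm, Complex.exp_ofReal_mul_I_im]
  rw [e2, e1, e3, fract_arg_exp, fract_arg_exp, fract_arg_exp]
  have h1 : θ / (2 * Real.pi) * (2 * Real.pi) = θ := by field_simp
  have h2 : Real.pi / (2 * Real.pi) = 1 / 2 := by field_simp
  have h3 : (Real.pi - θ) / (2 * Real.pi) = 1 / 2 - θ / (2 * Real.pi) := by
    rw [sub_div, h2]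
  rw [h2, h3]
  have h0 : 0 ≤ θ / (2 * Real.pi) := div_nonneg hθ.1 (by positivity)
  have h4 : θ / (2 * Real.pi) < 1 := by
    rw [div_lt_one (by positivity)]
    linarith [hθ.2]
  rw [Int.fract_eq_self.mpr ⟨h0, h4⟩, Int.fract_eq_self.mpr ⟨by norm_num, by norm_num⟩]
  rcases le_or_gt θ Real.pi with h | h
  · have h5 : θ / (2 * Real.pi) ≤ 1 / 2 := by
      rw [← h2]; gcongr
    rw [Int.fract_eq_self.mpr ⟨by linarith, by linarith⟩,
      if_neg (Real.sin_nonneg_of_nonneg_of_le_pi hθ.1 h).not_gt]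
    ring
  · have h5 : 1 / 2 < θ / (2 * Real.pi) := by
      rw [← h2]; gcongr
    have h6 : Real.sin θ < 0 := by
      have := Real.sin_pos_of_pos_of_lt_pi (x := θ - Real.pi) (by linarith) (by linarith [hθ.2])
      rw [Real.sin_sub_pi] at this
      linarith
    have h7 : Int.fract (1 / 2 - θ / (2 * Real.pi)) = 1 / 2 - θ / (2 * Real.pi) + 1 := by
      rw [Int.fract_eq_iff]
      exact ⟨by linarith, by linarith, -1, by push_cast; ring⟩
    rw [h7, if_pos h6]
    ring

/-- Here `W = -1`, so the diagonal form of `Y'` diagonalizes all three matrices and the claim splits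
into scalar ones. The link is `Im (u + ix)² = 2xu` together with `X'ᵀU' = Bᵀ diag(xu) B`. -/
theorem angleIndex_of_lower_eq_zero {n : ℕ} {Y Y' : Matrix (Fin n ⊕ Fin n) (Fin n) ℝ}
    (hY : IsLagrangian Y) (hY' : IsLagrangian Y') (h0 : lower Y = 0) :
    angleIndex Y Y' = ind ((upper Y')ᵀ * lower Y') := by
  obtain ⟨A, B, x, u, h1, h2, h3, h4, h5, h6⟩ := hY'.exists_diagonal_form
  have hW : souriau Y = -1 := by
    refine hY.souriau_eq_of_mul ?_
    simp [holo, antiholo, h0]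
  have hone : (-1 : Matrix (Fin n) (Fin n) ℂ)
      = 1 * Matrix.diagonal (fun _ => (-1 : ℂ)) * 1 := by
    rw [Matrix.one_mul, Matrix.mul_one, ← Matrix.diagonal_one, ← Matrix.diagonal_neg]
  have hAA : A.map Complex.ofReal * Aᵀ.map Complex.ofReal = 1 := by
    rw [← map_ofReal_mul, h2, map_ofReal_one]
  have hAA' : Aᵀ.map Complex.ofReal * A.map Complex.ofReal = 1 := by
    rw [← map_ofReal_mul, h1, map_ofReal_one]
  have hinv : -1 * (souriau Y')⁻¹ = A.map Complex.ofReal * Matrix.diagonal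
      (fun j => -((u j + Complex.I * x j : ℂ) ^ 2)⁻¹) * Aᵀ.map Complex.ofReal := by
    have : (souriau Y')⁻¹ = A.map Complex.ofReal * Matrix.diagonal
        (fun j => ((u j + Complex.I * x j : ℂ) ^ 2)⁻¹) * Aᵀ.map Complex.ofReal := by
      apply Matrix.inv_eq_left_inv
      rw [hY'.souriau_eq h1 h4 h5 h6]
      have hd : Matrix.diagonal (fun j => ((u j + Complex.I * x j : ℂ) ^ 2)⁻¹)
          * Matrix.diagonal (fun j => (u j + Complex.I * x j : ℂ) ^ 2) = 1 := by
        rw [Matrix.diagonal_mul_diagonal, ← Matrix.diagonal_one]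
        congr 1
        funext j
        refine inv_mul_cancel₀ fun hz => ?_
        have := norm_sq_of_unit (h4 j)
        rw [hz, norm_zero] at this
        exact zero_ne_one this
      calc _ = A.map Complex.ofReal * (Matrix.diagonal (fun j => ((u j + Complex.I * x j : ℂ) ^ 2)⁻¹)
            * (Aᵀ.map Complex.ofReal * A.map Complex.ofReal)
            * Matrix.diagonal (fun j => (u j + Complex.I * x j : ℂ) ^ 2))
            * Aᵀ.map Complex.ofReal := by simp only [Matrix.mul_assoc]
        _ = 1 := by rw [hAA', Matrix.mul_one, hd, Matrix.mul_one, hAA]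
    rw [this, neg_one_mul, ← Matrix.neg_mul, ← Matrix.mul_neg, ← Matrix.diagonal_neg]
  have hind : (upper Y')ᵀ * lower Y' = Bᵀ * Matrix.diagonal (fun j => x j * u j) * B := by
    rw [h5, h6, ← Matrix.diagonal_mul_diagonal]
    simp only [Matrix.transpose_mul, Matrix.diagonal_transpose, Matrix.mul_assoc]
    rw [← Matrix.mul_assoc Aᵀ, h1, Matrix.one_mul]
  have hr1 : (-1 : Matrix (Fin n) (Fin n) ℂ).charpoly.roots
      = (Finset.univ : Finset (Fin n)).val.map fun _ => (-1 : ℂ) := by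
    rw [hone]
    exact roots_charpoly_conj_diagonal (Matrix.one_mul 1) _
  rw [angleIndex, hW, hinv, hY'.roots_souriau h1 h4 h5 h6, hr1,
    roots_charpoly_conj_diagonal hAA', angleSum_map_univ, angleSum_map_univ, angleSum_map_univ,
    ← Finset.sum_sub_distrib, ← Finset.sum_add_distrib, hind, ind_congruence h3,
    Set.ncard_eq_toFinset_card']
  rw [Finset.sum_congr rfl fun j _ => angle_comparison (norm_sq_of_unit (h4 j)),
    Finset.sum_boole]
  congr 2
  ext j
  have him : ((u j + Complex.I * x j : ℂ) ^ 2).im = 2 * (x j * u j) := by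
    simp [sq]
    ring
  simp only [Finset.mem_filter, Finset.mem_univ, true_and, Set.mem_toFinset, Set.mem_ofPred_eq, him]
  constructor <;> intro h <;> linarith

/-- Deform the shear through `t • Q`, `0 ≤ t ≤ 1`. The upper blocks and the Wronskian do not change,
so the angle index can vary only with the floor sum of `Y`, which is itself constant since `rank X`
is. -/
theorem angleIndex_vShear {n : ℕ} {Y Y' : Matrix (Fin n ⊕ Fin n) (Fin n) ℝ}
    (hY : IsLagrangian Y) (hY' : IsLagrangian Y') {Q : Matrix (Fin n) (Fin n) ℝ} (hQ : Qᵀ = Q) :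
    angleIndex (vShear Q * Y) (vShear Q * Y') = angleIndex Y Y' := by
  have hmem : ∀ t : ℝ, vShear (t • Q) ∈ Matrix.symplecticGroup (Fin n) ℝ := fun t =>
    vShear_mem (by rw [Matrix.transpose_smul, hQ])
  have hpath : ∀ {Z : Matrix (Fin n ⊕ Fin n) (Fin n) ℝ}, IsLagrangian Z →
      IsLagrangianPath 0 1 fun t => vShear (t • Q) * Z := by
    intro Z hZ
    refine ⟨Continuous.continuousOn ?_, fun t _ => hZ.symplectic_mul (hmem t)⟩
    refine Continuous.matrix_mul ?_ continuous_const
    exact Continuous.matrix_fromBlocks continuous_const continuous_const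
      (continuous_id.smul continuous_const) continuous_const
  have hup : ∀ (t : ℝ) (Z : Matrix (Fin n ⊕ Fin n) (Fin n) ℝ),
      upper (vShear (t • Q) * Z) = upper Z := fun t Z => by
    rw [vShear_mul, upper_fromRows]
  obtain ⟨φ, hφ⟩ := exists_branches zero_lt_one (hpath hY).continuousOn_souriau
    fun t ht => ((hpath hY).2 t ht).norm_of_mem_roots
  have h1 := angleIndex_sub_sum_floor zero_lt_one (hpath hY) (hpath hY')
    (fun t _ => by rw [wronskian_symplectic_mul (hmem t)]) (fun t _ => by rw [hup]) hφ
  have h2 := sum_floor_eq hφ.1 (r := n - (upper Y).rank) (fun s hs => by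
      rw [← hφ.2 s hs, rank_eq_of_count ((hpath hY).2 s hs), hup])
    (s := 1) (t := 0) (by simp) (by simp)
  rw [h2, sub_self, Int.cast_zero, sub_eq_zero] at h1
  have h3 : vShear (0 : Matrix (Fin n) (Fin n) ℝ) = 1 := Matrix.fromBlocks_one
  rwa [one_smul, zero_smul, h3, Matrix.one_mul, Matrix.one_mul] at h1

/-- The shear by `-Q` makes the lower block of `Y` vanish. For a Lagrangian plane, `U = QX` forces
`X` to be invertible. -/
theorem angleIndex_of_isUnit {n : ℕ} {Y Y' : Matrix (Fin n ⊕ Fin n) (Fin n) ℝ}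
    (hY : IsLagrangian Y) (hY' : IsLagrangian Y') {Q : Matrix (Fin n) (Fin n) ℝ} (hQ : Qᵀ = Q)
    (hQY : lower Y = Q * upper Y) :
    angleIndex Y Y' = ind ((upper Y')ᵀ * lower Y' - (upper Y')ᵀ * Q * upper Y') := by
  have hQ' : (-Q)ᵀ = -Q := by rw [Matrix.transpose_neg, hQ]
  rw [← angleIndex_vShear hY hY' hQ', angleIndex_of_lower_eq_zero
    (hY.symplectic_mul (vShear_mem hQ')) (hY'.symplectic_mul (vShear_mem hQ'))]
  · simp only [vShear_mul, upper_fromRows, lower_fromRows, Matrix.mul_add, Matrix.neg_mul,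
      Matrix.mul_neg, Matrix.mul_assoc, sub_eq_add_neg]
  · rw [vShear_mul, lower_fromRows, hQY]
    simp

/-! ### Rotations -/

/-- The rotation `(X, U) ↦ (cos η X + sin η U, cos η U - sin η X)`. -/
noncomputable def rotation (n : ℕ) (η : ℝ) : Matrix (Fin n ⊕ Fin n) (Fin n ⊕ Fin n) ℝ :=
  Matrix.fromBlocks (Real.cos η • 1) (Real.sin η • 1) (-Real.sin η • 1) (Real.cos η • 1)

theorem rotation_mem (n : ℕ) (η : ℝ) : rotation n η ∈ Matrix.symplecticGroup (Fin n) ℝ := by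
  have h := Real.cos_sq_add_sin_sq η
  rw [SymplecticGroup.mem_iff, rotation, Matrix.J, Matrix.fromBlocks_transpose,
    Matrix.fromBlocks_multiply, Matrix.fromBlocks_multiply]
  simp only [Matrix.transpose_smul, Matrix.transpose_one, Matrix.mul_zero, Matrix.mul_neg,
    Matrix.mul_one, Matrix.mul_smul, zero_add, add_zero, smul_smul,
    ← neg_smul, ← add_smul]
  congr 1
  · exact smul_eq_zero_of_left (by ring) _
  · rw [← neg_one_smul ℝ (1 : Matrix (Fin n) (Fin n) ℝ)]
    congr 1
    linear_combination -h
  · conv_rhs => rw [← one_smul ℝ (1 : Matrix (Fin n) (Fin n) ℝ)]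
    congr 1
    linear_combination h
  · exact smul_eq_zero_of_left (by ring) _

theorem rotation_mul {n : ℕ} (η : ℝ) (Y : Matrix (Fin n ⊕ Fin n) (Fin n) ℝ) :
    rotation n η * Y = Matrix.fromRows (Real.cos η • upper Y + Real.sin η • lower Y)
      (Real.cos η • lower Y - Real.sin η • upper Y) := by
  conv_lhs => rw [← fromRows_upper_lower Y, rotation, Matrix.fromBlocks_mul_fromRows]
  simp only [Matrix.smul_mul, Matrix.one_mul, neg_smul, Matrix.neg_mul, sub_eq_add_neg]
  rw [add_comm (-_)]

theorem IsLagrangian.souriau_rotation {n : ℕ} {Y : Matrix (Fin n ⊕ Fin n) (Fin n) ℝ}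
    (hY : IsLagrangian Y) (η : ℝ) :
    souriau (rotation n η * Y) = Complex.exp (Complex.I * ((2 * η : ℝ) : ℂ)) • souriau Y := by
  refine (hY.symplectic_mul (rotation_mem n η)).souriau_eq_of_mul ?_
  have hsm : ∀ (c : ℝ) (M : Matrix (Fin n) (Fin n) ℝ),
      (c • M).map Complex.ofReal = (c : ℂ) • M.map Complex.ofReal := fun c M => by
    ext i j; simp
  have e0 : ∀ θ : ℝ, Complex.exp (Complex.I * (θ : ℂ))
      = (Real.cos θ : ℂ) + Complex.I * (Real.sin θ : ℂ) := fun θ => by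
    rw [mul_comm, Complex.exp_mul_I, Complex.ofReal_cos, Complex.ofReal_sin]
    ring
  have e1 : holo (rotation n η * Y) = Complex.exp (Complex.I * (η : ℂ)) • holo Y := by
    rw [e0, rotation_mul, holo, holo, upper_fromRows, lower_fromRows, map_ofReal_add,
      map_ofReal_sub, hsm, hsm, hsm, hsm]
    ext i j
    simp only [Matrix.add_apply, Matrix.sub_apply, Matrix.smul_apply, smul_eq_mul]
    linear_combination (-(Real.sin η : ℂ) * (upper Y).map Complex.ofReal i j) * Complex.I_sq
  have e2 : antiholo (rotation n η * Y)
      = Complex.exp (Complex.I * ((-η : ℝ) : ℂ)) • antiholo Y := by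
    rw [e0, rotation_mul, antiholo, antiholo, upper_fromRows, lower_fromRows, map_ofReal_add,
      map_ofReal_sub, hsm, hsm, hsm, hsm, Real.cos_neg, Real.sin_neg, Complex.ofReal_neg]
    ext i j
    simp only [Matrix.add_apply, Matrix.sub_apply, Matrix.smul_apply, smul_eq_mul]
    linear_combination (-(Real.sin η : ℂ) * (upper Y).map Complex.ofReal i j) * Complex.I_sq
  rw [e1, e2, Matrix.smul_mul, Matrix.mul_smul, smul_smul, ← Complex.exp_add, souriau,
    Matrix.mul_assoc, Matrix.nonsing_inv_mul _ hY.isUnit_antiholo, Matrix.mul_one]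
  congr 2
  push_cast
  ring

theorem roots_charpoly_smul {n : ℕ} {A : Matrix (Fin n) (Fin n) ℂ} {f : Fin n → ℂ}
    (h : A.charpoly.roots = Finset.univ.val.map f) {c : ℂ} (hc : c ≠ 0) :
    (c • A).charpoly.roots = Finset.univ.val.map fun j => c * f j := by
  have h1 : (c • A).charpoly = (1 * Matrix.diagonal (fun j => c * f j) * 1).charpoly := by
    refine Polynomial.funext fun z => ?_
    rw [Matrix.one_mul, Matrix.mul_one, Matrix.charpoly_diagonal, Polynomial.eval_prod]
    have h2 := eval_charpoly_eq_prod h (z / c)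
    rw [Matrix.eval_charpoly] at h2 ⊢
    have h3 : Matrix.scalar (Fin n) z - c • A = c • (Matrix.scalar (Fin n) (z / c) - A) := by
      ext i j
      simp only [Matrix.sub_apply, Matrix.smul_apply, Matrix.scalar_apply, Matrix.diagonal_apply,
        smul_eq_mul]
      split_ifs <;> field_simp
      ring
    rw [h3, Matrix.det_smul, h2, Fintype.card_fin, ← Fin.prod_const, ← Finset.prod_mul_distrib]
    refine Finset.prod_congr rfl fun j _ => ?_
    simp only [Polynomial.eval_sub, Polynomial.eval_X, Polynomial.eval_C]
    field_simp
  rw [h1]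
  exact roots_charpoly_conj_diagonal (Matrix.one_mul 1) _

/-- A normalized angle lies strictly below `1`, so a small increase causes no wrap-around. A
decrease from `0` would, hence the one-sided limit. -/
theorem eventually_fract_arg {z : ℂ} (hz : ‖z‖ = 1) :
    ∀ᶠ η : ℝ in nhdsWithin 0 (Set.Ioi 0),
      Int.fract ((Complex.exp (Complex.I * ((2 * η : ℝ) : ℂ)) * z).arg / (2 * Real.pi))
        = Int.fract (z.arg / (2 * Real.pi)) + η / Real.pi := by
  obtain ⟨θ, -, rfl⟩ := exists_angle hz 0
  have hlt := Int.fract_lt_one (θ / (2 * Real.pi))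
  have hpi := Real.pi_pos
  have hpos : 0 < (1 - Int.fract (θ / (2 * Real.pi))) * Real.pi :=
    mul_pos (sub_pos.mpr hlt) hpi
  filter_upwards [Ioo_mem_nhdsGT hpos] with η hη
  have e : Complex.exp (Complex.I * ((2 * η : ℝ) : ℂ)) * Complex.exp (Complex.I * (θ : ℂ))
      = Complex.exp (Complex.I * ((θ + 2 * η : ℝ) : ℂ)) := by
    rw [← Complex.exp_add]
    congr 1
    push_cast
    ring
  rw [e, fract_arg_exp, fract_arg_exp, Int.fract_eq_iff]
  have h1 : η / Real.pi < 1 - Int.fract (θ / (2 * Real.pi)) := by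
    rw [div_lt_iff₀ hpi]; exact hη.2
  have h2 : 0 < η / Real.pi := div_pos hη.1 hpi
  refine ⟨by linarith [Int.fract_nonneg (θ / (2 * Real.pi))], by linarith,
    ⌊θ / (2 * Real.pi)⌋, ?_⟩
  rw [Int.fract]
  field_simp
  ring

theorem eventually_angleSum_smul {n : ℕ} {A : Matrix (Fin n) (Fin n) ℂ}
    (hA : ∀ z ∈ A.charpoly.roots, ‖z‖ = 1) :
    ∀ᶠ η : ℝ in nhdsWithin 0 (Set.Ioi 0),
      angleSum (Complex.exp (Complex.I * ((2 * η : ℝ) : ℂ)) • A).charpoly.roots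
        = angleSum A.charpoly.roots + n * (η / Real.pi) := by
  obtain ⟨f, hf⟩ := exists_tuple_of_card (card_roots_charpoly A)
  have h1 : ∀ᶠ η : ℝ in nhdsWithin 0 (Set.Ioi 0), ∀ j,
      Int.fract ((Complex.exp (Complex.I * ((2 * η : ℝ) : ℂ)) * f j).arg / (2 * Real.pi))
        = Int.fract ((f j).arg / (2 * Real.pi)) + η / Real.pi :=
    Filter.eventually_all.mpr fun j => eventually_fract_arg
      (hA _ (by rw [hf]; exact Multiset.mem_map_of_mem _ (Finset.mem_univ j)))
  filter_upwards [h1] with η hη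
  rw [roots_charpoly_smul hf (Complex.exp_ne_zero _), hf, angleSum_map_univ, angleSum_map_univ,
    Finset.sum_congr rfl fun j _ => hη j, Finset.sum_add_distrib]
  simp

/-- The rotation multiplies `W` by `e^{2iη}`. Both `θ(W)` and `θ(W W'⁻¹)` grow by `nη/π`, and they
enter with opposite signs. -/
theorem eventually_angleIndex_rotation {n : ℕ} {Y Y' : Matrix (Fin n ⊕ Fin n) (Fin n) ℝ}
    (hY : IsLagrangian Y) (hY' : IsLagrangian Y') :
    ∀ᶠ η : ℝ in nhdsWithin 0 (Set.Ioi 0), angleIndex (rotation n η * Y) Y' = angleIndex Y Y' := by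
  obtain ⟨Z, hZ, -, hZc⟩ := hY.exists_relative hY'
  filter_upwards [eventually_angleSum_smul hY.norm_of_mem_roots,
    eventually_angleSum_smul (hZc ▸ hZ.norm_of_mem_roots)] with η h1 h2
  rw [angleIndex, hY.souriau_rotation, Matrix.smul_mul, h1, h2, angleIndex]
  ring

/-! ### The comparative index -/

theorem dotProduct_sub_gram_mulVec {n : ℕ} (N G : Matrix (Fin n) (Fin n) ℝ) (g c : Fin n → ℝ) :
    c ⬝ᵥ (N - Gᵀ * Matrix.diagonal g * G) *ᵥ c
      = c ⬝ᵥ N *ᵥ c - ∑ j, g j * (G *ᵥ c) j ^ 2 := by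
  rw [Matrix.sub_mulVec, dotProduct_sub]
  congr 1
  rw [← Matrix.mulVec_mulVec, ← Matrix.mulVec_mulVec, Matrix.dotProduct_mulVec,
    Matrix.vecMul_transpose]
  simp only [dotProduct, Matrix.mulVec_diagonal]
  exact Finset.sum_congr rfl fun j _ => by ring

/-- `M c = 0` says that `W(Y, Y') c` lies in the range of `Xᵀ`. Modulo that range it is `-Bᵀ diag(u)
AᵀX'c`, and `u_j ≠ 0` wherever `x_j = 0`. So the kernel of `M` consists of the `c` with `X'c` in the
range of `X`. -/
theorem matM_mulVec_eq_zero_iff {n : ℕ} {Y Y' : Matrix (Fin n ⊕ Fin n) (Fin n) ℝ}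
    {A B : Matrix (Fin n) (Fin n) ℝ} {x u : Fin n → ℝ} (hA : Aᵀ * A = 1)
    (hB : IsUnit B.det) (hxu : ∀ j, x j ^ 2 + u j ^ 2 = 1)
    (hX : upper Y = A * Matrix.diagonal x * B) (hU : lower Y = A * Matrix.diagonal u * B)
    (c : Fin n → ℝ) :
    matM Y Y' *ᵥ c = 0 ↔ ∀ j, x j = 0 → ((Aᵀ * upper Y') *ᵥ c) j = 0 := by
  obtain ⟨p1, p2, p3, p4⟩ := pinv_spec (upper Y)
  have hXt : (upper Y)ᵀ = Bᵀ * Matrix.diagonal x * Aᵀ := by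
    rw [hX]; simp only [Matrix.transpose_mul, Matrix.diagonal_transpose, Matrix.mul_assoc]
  have hUt : (lower Y)ᵀ = Bᵀ * Matrix.diagonal u * Aᵀ := by
    rw [hU]; simp only [Matrix.transpose_mul, Matrix.diagonal_transpose, Matrix.mul_assoc]
  have hBt : IsUnit Bᵀ.det := by rwa [Matrix.det_transpose]
  have hW : wronskian Y Y' *ᵥ c = (upper Y)ᵀ *ᵥ (lower Y' *ᵥ c)
      - Bᵀ *ᵥ (Matrix.diagonal u *ᵥ ((Aᵀ * upper Y') *ᵥ c)) := by
    rw [wronskian_eq, hUt, Matrix.sub_mulVec]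
    simp only [Matrix.mulVec_mulVec, Matrix.mul_assoc]
  rw [matM, ← Matrix.mulVec_mulVec, Matrix.sub_mulVec, Matrix.one_mulVec, sub_eq_zero]
  constructor
  · intro h j hj
    have h1 : wronskian Y Y' *ᵥ c
        = (upper Y)ᵀ *ᵥ ((pinv (upper Y))ᵀ *ᵥ (wronskian Y Y' *ᵥ c)) := by
      rw [Matrix.mulVec_mulVec, ← Matrix.transpose_mul, p4]
      exact h
    obtain ⟨d, hd⟩ : ∃ d, d = (pinv (upper Y))ᵀ *ᵥ (wronskian Y Y' *ᵥ c) := ⟨_, rfl⟩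
    rw [← hd, hW, sub_eq_iff_eq_add, add_comm, ← sub_eq_iff_eq_add, ← Matrix.mulVec_sub, hXt,
      ← Matrix.mulVec_mulVec, ← Matrix.mulVec_mulVec] at h1
    have h2 := Matrix.mulVec_injective_of_isUnit ((Matrix.isUnit_iff_isUnit_det _).mpr hBt) h1
    have h3 := congrFun h2 j
    rw [Matrix.mulVec_diagonal, Matrix.mulVec_diagonal, hj, zero_mul] at h3
    have hu : u j ≠ 0 := by
      intro hu
      have := hxu j
      rw [hj, hu] at this
      norm_num at this
    exact (mul_eq_zero.mp h3.symm).resolve_left hu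
  · intro h
    obtain ⟨f, hf⟩ : ∃ f : Fin n → ℝ, f = fun j => ((Aᵀ * upper Y') *ᵥ c) j / x j := ⟨_, rfl⟩
    have h1 : (Aᵀ * upper Y') *ᵥ c = Matrix.diagonal x *ᵥ f := by
      funext j
      rw [Matrix.mulVec_diagonal, hf]
      by_cases hj : x j = 0
      · rw [h j hj, hj, zero_mul]
      · field_simp
    have h2 : Bᵀ *ᵥ (Matrix.diagonal u *ᵥ ((Aᵀ * upper Y') *ᵥ c))
        = (upper Y)ᵀ *ᵥ ((A * Matrix.diagonal u) *ᵥ f) := by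
      rw [h1, hXt]
      simp only [Matrix.mulVec_mulVec]
      congr 1
      calc _ = Bᵀ * (Matrix.diagonal u * Matrix.diagonal x) := rfl
        _ = Bᵀ * (Matrix.diagonal x * Matrix.diagonal u) := by
          rw [Matrix.diagonal_mul_diagonal, Matrix.diagonal_mul_diagonal]
          simp only [mul_comm]
        _ = Bᵀ * Matrix.diagonal x * (Aᵀ * A) * Matrix.diagonal u := by
          rw [hA, Matrix.mul_one, Matrix.mul_assoc]
        _ = _ := by simp only [Matrix.mul_assoc]
    have h3 : pinv (upper Y) * upper Y * (upper Y)ᵀ = (upper Y)ᵀ := by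
      have := congrArg Matrix.transpose p1
      rwa [Matrix.mul_assoc, Matrix.transpose_mul, p4] at this
    rw [hW, h2, ← Matrix.mulVec_sub, Matrix.mulVec_mulVec, h3]

/-- `V` is the orthogonal projection onto `ker M`. -/
theorem matV_props {n : ℕ} (Y Y' : Matrix (Fin n ⊕ Fin n) (Fin n) ℝ) :
    (matV Y Y')ᵀ = matV Y Y' ∧ matM Y Y' * matV Y Y' = 0 ∧
      ∀ c, matM Y Y' *ᵥ c = 0 → matV Y Y' *ᵥ c = c := by
  obtain ⟨p1, p2, p3, p4⟩ := pinv_spec (matM Y Y')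
  refine ⟨?_, ?_, fun c hc => ?_⟩
  · rw [matV, Matrix.transpose_sub, Matrix.transpose_one, p4]
  · rw [matV, Matrix.mul_sub, Matrix.mul_one, ← Matrix.mul_assoc, p1, sub_self]
  · rw [matV, Matrix.sub_mulVec, Matrix.one_mulVec, ← Matrix.mulVec_mulVec, hc,
      Matrix.mulVec_zero, sub_zero]

/-- On the range of `V` the vectors `X'c` lie in the range of `X`, so `X X†` fixes them and the
pseudoinverse can be eliminated. The convention `u / 0 = 0` is harmless: those coordinates of
`AᵀX'V` vanish. -/
theorem matP_eq {n : ℕ} {Y Y' : Matrix (Fin n ⊕ Fin n) (Fin n) ℝ} (hY' : IsLagrangian Y')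
    {A B : Matrix (Fin n) (Fin n) ℝ} {x u : Fin n → ℝ} (hA : Aᵀ * A = 1)
    (hA' : A * Aᵀ = 1) (hB : IsUnit B.det) (hxu : ∀ j, x j ^ 2 + u j ^ 2 = 1)
    (hX : upper Y = A * Matrix.diagonal x * B) (hU : lower Y = A * Matrix.diagonal u * B) :
    matP Y Y' = matV Y Y' * ((upper Y')ᵀ * lower Y' - (Aᵀ * upper Y')ᵀ
      * Matrix.diagonal (fun j => u j / x j) * (Aᵀ * upper Y')) * matV Y Y' := by
  obtain ⟨p1, -, -, -⟩ := pinv_spec (upper Y)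
  obtain ⟨v1, v2, -⟩ := matV_props Y Y'
  obtain ⟨V, hV⟩ : ∃ V, V = matV Y Y' := ⟨_, rfl⟩
  obtain ⟨X', hX'⟩ : ∃ X', X' = upper Y' := ⟨_, rfl⟩
  obtain ⟨Xd, hXd⟩ : ∃ D, D = pinv (upper Y) := ⟨_, rfl⟩
  have hW : (wronskian Y Y')ᵀ = (lower Y')ᵀ * upper Y - X'ᵀ * lower Y := by
    rw [wronskian_eq, hX']
    simp
  have hsymm := (isLagrangian_iff.mp hY').1
  rw [← hX'] at hsymm
  have hzero : ∀ j k, x j = 0 → (Aᵀ * X' * V) j k = 0 := by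
    intro j k hj
    have h1 : matM Y Y' *ᵥ V.col k = 0 := by
      rw [← Matrix.mulVec_single_one, Matrix.mulVec_mulVec, hV, v2, Matrix.zero_mulVec]
    have h2 := (matM_mulVec_eq_zero_iff hA hB hxu hX hU _).mp h1 j hj
    rwa [← hX', ← Matrix.mulVec_single_one, Matrix.mulVec_mulVec, Matrix.mulVec_single_one] at h2
  have hGV : Aᵀ * X' * V = Matrix.diagonal x
      * (Matrix.diagonal (fun j => (x j)⁻¹) * (Aᵀ * X' * V)) := by
    rw [← Matrix.mul_assoc, Matrix.diagonal_mul_diagonal]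
    ext j k
    rw [Matrix.diagonal_mul]
    by_cases hj : x j = 0
    · rw [hzero j k hj, mul_zero]
    · rw [mul_inv_cancel₀ hj, one_mul]
  have hXV : upper Y * Xd * X' * V = X' * V := by
    obtain ⟨H, hH⟩ : ∃ H, H = Matrix.diagonal (fun j => (x j)⁻¹) * (Aᵀ * X' * V) := ⟨_, rfl⟩
    rw [← hH] at hGV
    have h1 : X' * V = upper Y * (B⁻¹ * H) := by
      calc X' * V = A * Aᵀ * (X' * V) := by rw [hA', Matrix.one_mul]
        _ = A * (Aᵀ * X' * V) := by simp only [Matrix.mul_assoc]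
        _ = A * Matrix.diagonal x * (B * B⁻¹) * H := by
          rw [hGV, Matrix.mul_nonsing_inv _ hB, Matrix.mul_one, Matrix.mul_assoc]
        _ = _ := by rw [hX]; simp only [Matrix.mul_assoc]
    rw [Matrix.mul_assoc, h1, ← Matrix.mul_assoc, hXd, p1]
  obtain ⟨K, hK⟩ : ∃ K, K = B * (Xd * (X' * V)) := ⟨_, rfl⟩
  have hxK : Aᵀ * X' * V = Matrix.diagonal x * K := by
    calc Aᵀ * X' * V = Aᵀ * (upper Y * Xd * X' * V) := by rw [hXV, Matrix.mul_assoc]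
      _ = Aᵀ * A * Matrix.diagonal x * K := by
        rw [hX, hK]
        simp only [Matrix.mul_assoc]
      _ = _ := by rw [hA, Matrix.one_mul]
  have hVt : Vᵀ = V := by rw [hV, v1]
  have hVXA : V * X'ᵀ * A = Kᵀ * Matrix.diagonal x := by
    have := congrArg Matrix.transpose hxK
    simp only [Matrix.transpose_mul, Matrix.transpose_transpose, Matrix.diagonal_transpose,
      hVt] at this
    rw [← this, Matrix.mul_assoc]
  have e1 : V * X'ᵀ * lower Y * Xd * X' * V
      = Kᵀ * (Matrix.diagonal x * Matrix.diagonal u) * K := by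
    calc _ = V * X'ᵀ * A * Matrix.diagonal u * (B * (Xd * (X' * V))) := by
          rw [hU]; simp only [Matrix.mul_assoc]
      _ = _ := by rw [hVXA, ← hK]; simp only [Matrix.mul_assoc]
  have e2 : V * ((Aᵀ * X')ᵀ * Matrix.diagonal (fun j => u j / x j) * (Aᵀ * X')) * V
      = Kᵀ * (Matrix.diagonal x * Matrix.diagonal (fun j => u j / x j) * Matrix.diagonal x) * K := by
    calc _ = V * X'ᵀ * A * Matrix.diagonal (fun j => u j / x j) * (Aᵀ * X' * V) := by
          simp only [Matrix.transpose_mul, Matrix.transpose_transpose, Matrix.mul_assoc]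
      _ = _ := by rw [hVXA, hxK]; simp only [Matrix.mul_assoc]
  have e3 : Matrix.diagonal x * Matrix.diagonal (fun j => u j / x j) * Matrix.diagonal x
      = Matrix.diagonal x * Matrix.diagonal u := by
    rw [Matrix.diagonal_mul_diagonal, Matrix.diagonal_mul_diagonal, Matrix.diagonal_mul_diagonal]
    congr 1
    funext j
    by_cases hj : x j = 0
    · simp [hj]
    · field_simp
  have e4 : V * (lower Y')ᵀ * upper Y * Xd * X' * V = V * (X'ᵀ * lower Y') * V := by
    have h1 : V * (lower Y')ᵀ * upper Y * Xd * X' * V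
        = V * (lower Y')ᵀ * (upper Y * Xd * X' * V) := by simp only [Matrix.mul_assoc]
    rw [h1, hXV, hsymm]
    simp only [Matrix.mul_assoc]
  have e5 : V * (wronskian Y Y')ᵀ * Xd * X' * V
      = V * (lower Y')ᵀ * upper Y * Xd * X' * V - V * X'ᵀ * lower Y * Xd * X' * V := by
    rw [hW]
    simp only [Matrix.mul_sub, Matrix.sub_mul, Matrix.mul_assoc]
  have e6 : matP Y Y' = V * (wronskian Y Y')ᵀ * Xd * X' * V := by
    rw [hV, hXd, hX', matP]
  rw [e6, e5, e4, e1, ← e3, ← e2, ← hX', ← hV, Matrix.mul_sub, Matrix.sub_mul]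

/-- A family of quadratic forms with a pole along finitely many squares at `η = 0` is eventually
negative definite on a subspace on which the limiting form is negative definite. -/
theorem eventually_negative_on {n : ℕ} {N G : Matrix (Fin n) (Fin n) ℝ} {x u : Fin n → ℝ}
    (hxu : ∀ j, x j ^ 2 + u j ^ 2 = 1) {T : Submodule ℝ (Fin n → ℝ)}
    (hT : ∀ c ∈ T, c ≠ 0 → (∀ j, x j = 0 → (G *ᵥ c) j = 0) →
      c ⬝ᵥ (N - Gᵀ * Matrix.diagonal (fun j => u j / x j) * G) *ᵥ c < 0) :
    ∀ᶠ η : ℝ in nhdsWithin 0 (Set.Ioi 0), ∀ c ∈ T, c ≠ 0 →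
      c ⬝ᵥ (N - Gᵀ * Matrix.diagonal (fun j => (Real.cos η * u j - Real.sin η * x j)
        / (Real.cos η * x j + Real.sin η * u j)) * G) *ᵥ c < 0 := by
  -- The form splits into a part `Ψ` continuous at `η = 0` and the pole `-(cot η) Z`: for `x_j = 0`
  -- the coefficient is `cos η / sin η`, as `u_j` cancels.
  obtain ⟨Ψ, hΨ⟩ : ∃ Ψ : ℝ × (Fin n → ℝ) → ℝ, Ψ = fun p => p.2 ⬝ᵥ N *ᵥ p.2 - ∑ j,
    (if x j = 0 then 0 else (Real.cos p.1 * u j - Real.sin p.1 * x j)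
      / (Real.cos p.1 * x j + Real.sin p.1 * u j)) * (G *ᵥ p.2) j ^ 2 := ⟨_, rfl⟩
  obtain ⟨Z, hZ⟩ : ∃ Z : (Fin n → ℝ) → ℝ, Z = fun c =>
    ∑ j, (if x j = 0 then 1 else 0) * (G *ᵥ c) j ^ 2 := ⟨_, rfl⟩
  have hG : Continuous fun c : Fin n → ℝ => G *ᵥ c := continuous_const.matrix_mulVec continuous_id
  have hN : Continuous fun c : Fin n → ℝ => N *ᵥ c := continuous_const.matrix_mulVec continuous_id
  have hΨc : ∀ c, ContinuousAt Ψ (0, c) := by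
    intro c
    rw [hΨ]
    refine ContinuousAt.sub ?_ ?_
    · exact (continuous_snd.dotProduct (hN.comp continuous_snd)).continuousAt
    · refine tendsto_finsetSum _ fun j _ => ContinuousAt.mul ?_ ?_
      · by_cases hj : x j = 0
        · simp only [hj, if_true]
          exact continuousAt_const
        · simp only [hj, if_false]
          refine ContinuousAt.div (by fun_prop) (by fun_prop) ?_
          simpa using hj
      · exact (((continuous_apply j).comp (hG.comp continuous_snd)).pow 2).continuousAt
  have hZc : Continuous Z := by
    rw [hZ]
    exact continuous_finsetSum _ fun j _ =>
      continuous_const.mul (((continuous_apply j).comp hG).pow 2)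
  have hZ0 : ∀ c, 0 ≤ Z c := fun c => by
    rw [hZ]
    exact Finset.sum_nonneg fun j _ => mul_nonneg (by split_ifs <;> norm_num) (sq_nonneg _)
  have hform : ∀ η : ℝ, 0 < Real.sin η → ∀ c,
      c ⬝ᵥ (N - Gᵀ * Matrix.diagonal (fun j => (Real.cos η * u j - Real.sin η * x j)
        / (Real.cos η * x j + Real.sin η * u j)) * G) *ᵥ c
      = Ψ (η, c) - Real.cos η / Real.sin η * Z c := by
    intro η hη c
    rw [dotProduct_sub_gram_mulVec, hΨ, hZ]
    simp only
    rw [sub_sub, Finset.mul_sum, ← Finset.sum_add_distrib]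
    congr 1
    refine Finset.sum_congr rfl fun j _ => ?_
    by_cases hj : x j = 0
    · have hu : u j ≠ 0 := by
        intro hu
        have := hxu j
        rw [hj, hu] at this
        norm_num at this
      simp only [hj, if_true, mul_zero, sub_zero, zero_add, zero_mul]
      rw [mul_div_mul_right _ _ hu]
      ring
    · simp only [hj, if_false]
      ring
  have hK : IsCompact {c : Fin n → ℝ | c ∈ T ∧ ‖c‖ = 1} := by
    have : {c : Fin n → ℝ | c ∈ T ∧ ‖c‖ = 1} = Metric.sphere 0 1 ∩ (T : Set (Fin n → ℝ)) := by
      ext c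
      simp [and_comm]
    rw [this]
    exact (isCompact_sphere 0 1).inter_right T.closed_of_finiteDimensional
  -- By compactness of the unit sphere of `T` it is enough to argue near each unit vector `c`. If `Z
  -- c = 0`, then `Ψ (0, c) < 0` by hypothesis and the pole term only helps; if `Z c > 0`, the pole
  -- dominates.
  have hmain : ∀ᶠ η : ℝ in nhds 0, ∀ c ∈ {c : Fin n → ℝ | c ∈ T ∧ ‖c‖ = 1},
      0 < η → Ψ (η, c) - Real.cos η / Real.sin η * Z c < 0 := by
    refine hK.eventually_forall_of_forall_eventually fun c hc => ?_
    have hc0 : c ≠ 0 := fun h => by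
      have := hc.2
      rw [h, norm_zero] at this
      exact zero_ne_one this
    have hsmall : ∀ᶠ p : ℝ × (Fin n → ℝ) in nhds (0, c), p.1 < 1 :=
      (continuous_fst.tendsto ((0 : ℝ), c)).eventually (gt_mem_nhds one_pos)
    have hsin : ∀ η : ℝ, 0 < η → η < 1 → 0 < Real.sin η := fun η h0 h1 =>
      Real.sin_pos_of_pos_of_lt_pi h0 (by linarith [Real.pi_gt_three])
    have hcos : ∀ η : ℝ, 0 < η → η < 1 → 0 < Real.cos η := fun η h0 h1 =>
      Real.cos_pos_of_mem_Ioo ⟨by linarith [Real.pi_gt_three], by linarith [Real.pi_gt_three]⟩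
    by_cases hker : ∀ j, x j = 0 → (G *ᵥ c) j = 0
    · have h1 : Ψ (0, c) < 0 := by
        have h2 := hT c hc.1 hc0 hker
        rw [dotProduct_sub_gram_mulVec] at h2
        convert h2 using 1
        rw [hΨ]
        simp only [Real.cos_zero, Real.sin_zero, one_mul, zero_mul, sub_zero, add_zero]
        congr 1
        refine Finset.sum_congr rfl fun j _ => ?_
        by_cases hj : x j = 0
        · simp [hj]
        · simp [hj]
      filter_upwards [(hΨc c).eventually (gt_mem_nhds h1), hsmall] with p hp1 hp2 hp0
      have : 0 ≤ Real.cos p.1 / Real.sin p.1 * Z p.2 :=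
        mul_nonneg (div_nonneg (hcos _ hp0 hp2).le (hsin _ hp0 hp2).le) (hZ0 _)
      linarith
    · push Not at hker
      obtain ⟨j₀, hj₀, hGj₀⟩ := hker
      have hZpos : 0 < Z c := by
        rw [hZ]
        refine Finset.sum_pos' (fun j _ => mul_nonneg (by split_ifs <;> norm_num) (sq_nonneg _))
          ⟨j₀, Finset.mem_univ _, ?_⟩
        rw [if_pos hj₀, one_mul]
        positivity
      -- Multiplying by `sin η > 0` removes the pole; the value at `η = 0` is `-Z c`.
      have hΦ : ContinuousAt (fun p : ℝ × (Fin n → ℝ) =>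
          Real.sin p.1 * Ψ p - Real.cos p.1 * Z p.2) (0, c) := by
        refine ContinuousAt.sub (ContinuousAt.mul ?_ (hΨc c)) (ContinuousAt.mul ?_ ?_)
        · exact (Real.continuous_sin.comp continuous_fst).continuousAt
        · exact (Real.continuous_cos.comp continuous_fst).continuousAt
        · exact (hZc.comp continuous_snd).continuousAt
      have h1 : Real.sin (0 : ℝ) * Ψ (0, c) - Real.cos 0 * Z c < 0 := by
        rw [Real.sin_zero, Real.cos_zero]
        linarith
      filter_upwards [hΦ.eventually (gt_mem_nhds h1), hsmall] with p hp1 hp2 hp0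
      have h2 := hsin _ hp0 hp2
      have h3 : Real.sin p.1 * (Ψ p - Real.cos p.1 / Real.sin p.1 * Z p.2) < 0 := by
        rw [mul_sub, ← mul_assoc, mul_div_cancel₀ _ h2.ne']
        exact hp1
      exact neg_of_mul_neg_right h3 h2.le
  have hone : ∀ᶠ η : ℝ in nhdsWithin 0 (Set.Ioi 0), η < 1 :=
    (gt_mem_nhds one_pos : ∀ᶠ η : ℝ in nhds 0, η < 1).filter_mono nhdsWithin_le_nhds
  filter_upwards [hmain.filter_mono nhdsWithin_le_nhds, self_mem_nhdsWithin, hone]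
    with η hη hη0 hη1 c hc hc0
  have hη0' : 0 < η := hη0
  have hsinη : 0 < Real.sin η := Real.sin_pos_of_pos_of_lt_pi hη0' (by linarith [Real.pi_gt_three])
  have hnorm : 0 < ‖c‖ := norm_pos_iff.mpr hc0
  have h1 := hη (‖c‖⁻¹ • c) ⟨T.smul_mem _ hc, by
    rw [norm_smul, norm_inv, norm_norm, inv_mul_cancel₀ hnorm.ne']⟩ hη0'
  rw [← hform η hsinη, Matrix.mulVec_smul, smul_dotProduct, dotProduct_smul, smul_smul,
    smul_eq_mul] at h1
  exact neg_of_mul_neg_right h1 (by positivity)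

theorem sub_gram_transpose {n : ℕ} {Y' : Matrix (Fin n ⊕ Fin n) (Fin n) ℝ}
    (hY' : IsLagrangian Y') (G : Matrix (Fin n) (Fin n) ℝ) (g : Fin n → ℝ) :
    ((upper Y')ᵀ * lower Y' - Gᵀ * Matrix.diagonal g * G)ᵀ
      = (upper Y')ᵀ * lower Y' - Gᵀ * Matrix.diagonal g * G := by
  have := (isLagrangian_iff.mp hY').1
  simp only [Matrix.transpose_sub, Matrix.transpose_mul, Matrix.transpose_transpose,
    Matrix.diagonal_transpose, Matrix.mul_assoc, this]

/-- Rotating by a small `η > 0` leaves the angle index unchanged and turns it into the index of `F =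
X'ᵀU' - Gᵀ diag(g) G`. This index is compared with `rank M + ind P` through `K = ker M`, on which
`P` is the limiting form `N`. -/
theorem compIndex_eq_angleIndex {n : ℕ} {Y Y' : Matrix (Fin n ⊕ Fin n) (Fin n) ℝ}
    (hY : IsLagrangian Y) (hY' : IsLagrangian Y') : (compIndex Y Y' : ℝ) = angleIndex Y Y' := by
  obtain ⟨A, B, x, u, hA, hA', hB, hxu, hX, hU⟩ := hY.exists_diagonal_form
  obtain ⟨G, hG⟩ : ∃ G, G = Aᵀ * upper Y' := ⟨_, rfl⟩
  obtain ⟨v1, v2, v3⟩ := matV_props Y Y'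
  have hP := matP_eq hY' hA hA' hB hxu hX hU
  have hker := matM_mulVec_eq_zero_iff (Y' := Y') hA hB hxu hX hU
  rw [← hG] at hP hker
  obtain ⟨V, hV⟩ : ∃ V, V = matV Y Y' := ⟨_, rfl⟩
  rw [← hV] at v1 v2 v3 hP
  obtain ⟨N, hN⟩ : ∃ N, N = (upper Y')ᵀ * lower Y'
    - Gᵀ * Matrix.diagonal (fun j => u j / x j) * G := ⟨_, rfl⟩
  have hNt : Nᵀ = N := by rw [hN, sub_gram_transpose hY']
  rw [← hN] at hP
  have hPt : (matP Y Y')ᵀ = matP Y Y' := by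
    rw [hP, Matrix.transpose_mul, Matrix.transpose_mul, v1, hNt, Matrix.mul_assoc]
  have hPform : ∀ c, c ⬝ᵥ matP Y Y' *ᵥ c = (V *ᵥ c) ⬝ᵥ N *ᵥ (V *ᵥ c) := by
    intro c
    rw [hP, ← Matrix.mulVec_mulVec, ← Matrix.mulVec_mulVec, Matrix.dotProduct_mulVec,
      ← Matrix.mulVec_transpose, v1]
  obtain ⟨K, hK⟩ : ∃ K, K = LinearMap.ker (matM Y Y').mulVecLin := ⟨_, rfl⟩
  have hKmem : ∀ c, c ∈ K ↔ matM Y Y' *ᵥ c = 0 := fun c => by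
    rw [hK, LinearMap.mem_ker, Matrix.mulVecLin_apply]
  have hKV : ∀ c, V *ᵥ c ∈ K := fun c => by
    rw [hKmem, Matrix.mulVec_mulVec, v2, Matrix.zero_mulVec]
  have hKrank : (matM Y Y').rank + Module.finrank ℝ K = n := by
    have := LinearMap.finrank_range_add_finrank_ker (matM Y Y').mulVecLin
    rw [Module.finrank_fin_fun] at this
    rw [hK]
    exact this
  obtain ⟨S, hSrank, hS⟩ := exists_negative_subspace hPt
  have hSV : ∀ c ∈ S, V *ᵥ c = 0 → c = 0 := by
    intro c hc h0
    by_contra hne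
    have := hS c hc hne
    rw [hPform, h0] at this
    simp at this
  let S' := S.map V.mulVecLin
  have hS'rank : Module.finrank ℝ S' = ind (matP Y Y') := by
    rw [← hSrank]
    have hinj : Function.Injective (V.mulVecLin.domRestrict S) := by
      rw [← LinearMap.ker_eq_bot, LinearMap.ker_eq_bot']
      intro c hc
      exact Subtype.ext (hSV c c.2 hc)
    have := LinearMap.finrank_range_of_inj hinj
    rwa [LinearMap.range_domRestrict] at this
  have hS'K : S' ≤ K := by
    rintro _ ⟨c, -, rfl⟩
    exact hKV c
  have hS'neg : ∀ c ∈ S', c ≠ 0 → c ⬝ᵥ N *ᵥ c < 0 := by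
    rintro _ ⟨c, hc, rfl⟩ hne
    have := hS c hc (fun h => hne (by rw [h, map_zero]))
    rwa [hPform] at this
  -- `S'` is a maximal negative subspace of `N` inside `K`. Adding a complement of `K` raises the
  -- dimension by `rank M`, and the new directions become negative because of the pole.
  obtain ⟨C, hC⟩ := Submodule.exists_isCompl K
  have hTK : (S' ⊔ C) ⊓ K = S' := by
    rw [sup_inf_assoc_of_le _ hS'K, inf_comm, hC.inf_eq_bot, sup_bot_eq]
  have hTrank : Module.finrank ℝ (S' ⊔ C : Submodule ℝ (Fin n → ℝ))
      = (matM Y Y').rank + ind (matP Y Y') := by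
    have h1 := Submodule.finrank_sup_add_finrank_inf_eq S' C
    have h2 : S' ⊓ C = ⊥ := by
      rw [eq_bot_iff, ← hC.inf_eq_bot]
      exact inf_le_inf_right C hS'K
    have h3 := Submodule.finrank_add_eq_of_isCompl hC
    rw [h2, finrank_bot, hS'rank] at h1
    rw [Module.finrank_fin_fun] at h3
    omega
  have hneg := eventually_negative_on (N := (upper Y')ᵀ * lower Y') (G := G) hxu
    (T := S' ⊔ C) (fun c hc hne hz => by
      rw [← hN]
      refine hS'neg c ?_ hne
      rw [← hTK]
      exact ⟨hc, (hKmem c).mpr ((hker c).mpr hz)⟩)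
  have hden : ∀ᶠ η : ℝ in nhdsWithin 0 (Set.Ioi 0), ∀ j, x j ≠ 0 →
      0 < x j * (Real.cos η * x j + Real.sin η * u j) := by
    refine Filter.Eventually.filter_mono nhdsWithin_le_nhds ?_
    rw [Filter.eventually_all]
    intro j
    by_cases hj : x j = 0
    · exact Filter.Eventually.of_forall fun η h => absurd hj h
    · have hc : ContinuousAt (fun η => x j * (Real.cos η * x j + Real.sin η * u j)) 0 := by
        fun_prop
      have h0 : 0 < x j * (Real.cos 0 * x j + Real.sin 0 * u j) := by
        rw [Real.cos_zero, Real.sin_zero, one_mul, zero_mul, add_zero]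
        exact mul_self_pos.mpr hj
      exact (hc.eventually (lt_mem_nhds h0)).mono fun η h _ => h
  have hsin : ∀ᶠ η : ℝ in nhdsWithin 0 (Set.Ioi 0), 0 < Real.sin η := by
    filter_upwards [Ioo_mem_nhdsGT Real.pi_pos] with η hη
    exact Real.sin_pos_of_pos_of_lt_pi hη.1 hη.2
  -- One fixed small `η` satisfying all the conditions is enough; no limit is taken afterwards.
  obtain ⟨η, hneg, hden, hsin, hang⟩ :=
    (hneg.and (hden.and (hsin.and (eventually_angleIndex_rotation hY hY')))).exists
  have hne : ∀ j, Real.cos η * x j + Real.sin η * u j ≠ 0 := by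
    intro j
    by_cases hj : x j = 0
    · have hu : u j ≠ 0 := by
        intro hu
        have := hxu j
        rw [hj, hu] at this
        norm_num at this
      rw [hj, mul_zero, zero_add]
      exact mul_ne_zero hsin.ne' hu
    · exact fun h => by simpa [h] using hden j hj
  obtain ⟨g, hg⟩ : ∃ g : Fin n → ℝ, g = fun j => (Real.cos η * u j - Real.sin η * x j)
    / (Real.cos η * x j + Real.sin η * u j) := ⟨_, rfl⟩
  rw [← hg] at hneg
  have hQ : (A * Matrix.diagonal g * Aᵀ)ᵀ = A * Matrix.diagonal g * Aᵀ := by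
    simp only [Matrix.transpose_mul, Matrix.transpose_transpose, Matrix.diagonal_transpose,
      Matrix.mul_assoc]
  have hlow : lower (rotation n η * Y) = A * Matrix.diagonal g * Aᵀ * upper (rotation n η * Y) := by
    rw [rotation_mul, lower_fromRows, upper_fromRows, hX, hU]
    have e1 : Real.cos η • (A * Matrix.diagonal x * B) + Real.sin η • (A * Matrix.diagonal u * B)
        = A * Matrix.diagonal (fun j => Real.cos η * x j + Real.sin η * u j) * B := by
      have : Matrix.diagonal (fun j => Real.cos η * x j + Real.sin η * u j)
          = Real.cos η • Matrix.diagonal x + Real.sin η • Matrix.diagonal u := by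
        rw [← Matrix.diagonal_smul, ← Matrix.diagonal_smul, Matrix.diagonal_add]; rfl
      rw [this]
      simp only [Matrix.mul_add, Matrix.add_mul, Matrix.mul_smul, Matrix.smul_mul]
    have e2 : Real.cos η • (A * Matrix.diagonal u * B) - Real.sin η • (A * Matrix.diagonal x * B)
        = A * Matrix.diagonal (fun j => Real.cos η * u j - Real.sin η * x j) * B := by
      have : Matrix.diagonal (fun j => Real.cos η * u j - Real.sin η * x j)
          = Real.cos η • Matrix.diagonal u - Real.sin η • Matrix.diagonal x := by
        rw [← Matrix.diagonal_smul, ← Matrix.diagonal_smul, Matrix.diagonal_sub]; rfl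
      rw [this]
      simp only [Matrix.mul_sub, Matrix.sub_mul, Matrix.mul_smul, Matrix.smul_mul]
    rw [e1, e2]
    have e3 : Matrix.diagonal (fun j => Real.cos η * u j - Real.sin η * x j)
        = Matrix.diagonal g
          * Matrix.diagonal (fun j => Real.cos η * x j + Real.sin η * u j) := by
      rw [Matrix.diagonal_mul_diagonal]
      congr 1
      funext j
      rw [hg]
      exact (div_mul_cancel₀ _ (hne j)).symm
    rw [e3]
    have e4 : ∀ M : Matrix (Fin n) (Fin n) ℝ, Aᵀ * (A * M) = M := fun M => by
      rw [← Matrix.mul_assoc, hA, Matrix.one_mul]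
    simp only [Matrix.mul_assoc, e4]
  have hF : (upper Y')ᵀ * (A * Matrix.diagonal g * Aᵀ) * upper Y'
      = Gᵀ * Matrix.diagonal g * G := by
    rw [hG]
    simp only [Matrix.transpose_mul, Matrix.transpose_transpose, Matrix.mul_assoc]
  rw [← hang, angleIndex_of_isUnit (hY.symplectic_mul (rotation_mem n η)) hY' hQ hlow, hF,
    compIndex]
  congr 1
  have hFt := sub_gram_transpose hY' G g
  refine le_antisymm ?_ ?_
  · rw [← hTrank]
    exact finrank_le_ind hFt hneg
  -- Conversely, a negative subspace `T` of `F` meets `K` in a negative subspace of `P`, and `dim T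
  -- ≤ dim (T ⊓ K) + n - dim K`.
  · obtain ⟨T, hTr, hT⟩ := exists_negative_subspace hFt
    have h1 : Module.finrank ℝ (T ⊓ K : Submodule ℝ (Fin n → ℝ)) ≤ ind (matP Y Y') := by
      refine finrank_le_ind hPt fun c hc hc0 => ?_
      have hMc := (hKmem c).mp hc.2
      have h2 := hT c hc.1 hc0
      rw [hPform, v3 c hMc, hN, dotProduct_sub_gram_mulVec]
      rw [dotProduct_sub_gram_mulVec] at h2
      -- On `K` the terms with `x_j = 0` vanish. In the others `u_j / x_j ≥ g_j`, since rotation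
      -- decreases the cotangent, so `N ≤ F` there.
      have h3 : ∑ j, g j * (G *ᵥ c) j ^ 2 ≤ ∑ j, u j / x j * (G *ᵥ c) j ^ 2 := by
        refine Finset.sum_le_sum fun j _ => ?_
        by_cases hj : x j = 0
        · rw [(hker c).mp hMc j hj]
          simp
        · refine mul_le_mul_of_nonneg_right ?_ (sq_nonneg _)
          have h4 : u j / x j - g j
              = Real.sin η / (x j * (Real.cos η * x j + Real.sin η * u j)) := by
            rw [hg, div_sub_div _ _ hj (hne j)]
            congr 1
            linear_combination Real.sin η * hxu j
          have h5 : 0 ≤ u j / x j - g j := by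
            rw [h4]
            exact (div_pos hsin (hden j hj)).le
          linarith
      linarith
    have h2 := Submodule.finrank_sup_add_finrank_inf_eq T K
    have h3 := Submodule.finrank_le (T ⊔ K)
    rw [Module.finrank_fin_fun] at h3
    omega

/-! ### The reflection exchanging the comparative index and its dual -/

/-- The reflection `(X, U) ↦ (-X, U)`. -/
def reflect {n : ℕ} (Y : Matrix (Fin n ⊕ Fin n) (Fin n) ℝ) : Matrix (Fin n ⊕ Fin n) (Fin n) ℝ :=
  Matrix.fromRows (-upper Y) (lower Y)

@[simp]
theorem upper_reflect {n : ℕ} (Y : Matrix (Fin n ⊕ Fin n) (Fin n) ℝ) :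
    upper (reflect Y) = -upper Y := upper_fromRows _ _

@[simp]
theorem lower_reflect {n : ℕ} (Y : Matrix (Fin n ⊕ Fin n) (Fin n) ℝ) :
    lower (reflect Y) = lower Y := lower_fromRows _ _

theorem wronskian_reflect {n : ℕ} (Y Y' : Matrix (Fin n ⊕ Fin n) (Fin n) ℝ) :
    wronskian (reflect Y) (reflect Y') = -wronskian Y Y' := by
  rw [wronskian_eq, wronskian_eq, upper_reflect, upper_reflect, lower_reflect, lower_reflect,
    Matrix.transpose_neg, Matrix.neg_mul, Matrix.mul_neg]
  abel

theorem IsLagrangian.reflect {n : ℕ} {Y : Matrix (Fin n ⊕ Fin n) (Fin n) ℝ}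
    (hY : IsLagrangian Y) : IsLagrangian (reflect Y) := by
  rw [isLagrangian_iff] at hY ⊢
  simpa using hY

theorem IsLagrangianPath.reflect {n : ℕ} {a b : ℝ} {Y : ℝ → Matrix (Fin n ⊕ Fin n) (Fin n) ℝ}
    (hY : IsLagrangianPath a b Y) :
    IsLagrangianPath a b fun t => LagrangianPath.reflect (Y t) := by
  refine ⟨?_, fun t ht => (hY.2 t ht).reflect⟩
  have h : Continuous fun M : Matrix (Fin n ⊕ Fin n) (Fin n) ℝ => LagrangianPath.reflect M := by
    refine continuous_matrix fun i j => ?_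
    rcases i with i | i
    · exact (continuous_id.matrix_elem (Sum.inl i) j).neg
    · exact continuous_id.matrix_elem (Sum.inr i) j
  exact h.comp_continuousOn hY.1

theorem pinv_neg {m n : Type*} [Fintype m] [Fintype n] (A : Matrix m n ℝ) :
    pinv (-A) = -pinv A := by
  obtain ⟨h1, h2, h3, h4⟩ := pinv_spec A
  refine (pinv_spec (-A)).unique ⟨?_, ?_, ?_, ?_⟩
  · simpa using h1
  · simpa using h2
  · simpa using h3
  · simpa using h4

theorem matM_reflect {n : ℕ} (Y Y' : Matrix (Fin n ⊕ Fin n) (Fin n) ℝ) :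
    matM (reflect Y) (reflect Y') = -matM Y Y' := by
  simp [matM, wronskian_reflect, pinv_neg]

/-- `V` is unchanged, while the Wronskian, `X†` and `X'` each change sign; three signs leave one. -/
theorem matP_reflect {n : ℕ} (Y Y' : Matrix (Fin n ⊕ Fin n) (Fin n) ℝ) :
    matP (reflect Y) (reflect Y') = -matP Y Y' := by
  simp [matP, matV, matM_reflect, wronskian_reflect, pinv_neg]

theorem rank_neg {m n : Type*} [Fintype m] [Fintype n] (A : Matrix m n ℝ) :
    (-A).rank = A.rank := by
  have h : (-A).mulVecLin = -A.mulVecLin := by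
    ext1 c
    simp
  rw [Matrix.rank, h, LinearMap.range_neg, Matrix.rank]

theorem compIndex_reflect {n : ℕ} (Y Y' : Matrix (Fin n ⊕ Fin n) (Fin n) ℝ) :
    compIndex (reflect Y) (reflect Y') = dualCompIndex Y Y' := by
  rw [compIndex, dualCompIndex, matM_reflect, matP_reflect, rank_neg]

/-- Replacing `x_j` by `-x_j` inverts the unimodular number `(u_j + i x_j)²`. -/
theorem IsLagrangian.roots_souriau_reflect {n : ℕ} {Y : Matrix (Fin n ⊕ Fin n) (Fin n) ℝ}
    (hY : IsLagrangian Y) :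
    (souriau (LagrangianPath.reflect Y)).charpoly.roots
      = (souriau Y).charpoly.roots.map fun z => z⁻¹ := by
  obtain ⟨A, B, x, u, hA, hA', hB, hxu, hX, hU⟩ := hY.exists_diagonal_form
  have hX' : upper (LagrangianPath.reflect Y) = A * Matrix.diagonal (fun j => -x j) * B := by
    rw [upper_reflect, hX, ← Matrix.diagonal_neg, Matrix.mul_neg, Matrix.neg_mul]
  rw [hY.roots_souriau hA hxu hX hU, hY.reflect.roots_souriau hA (by simpa using hxu) hX'
    (by rw [lower_reflect, hU]), Multiset.map_map]
  refine Multiset.map_congr rfl fun j _ => ?_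
  have h : (x j : ℂ) ^ 2 + (u j : ℂ) ^ 2 = 1 := by exact_mod_cast hxu j
  refine eq_inv_of_mul_eq_one_left ?_
  rw [← mul_pow]
  have h1 : ((u j : ℂ) + Complex.I * ((-x j : ℝ) : ℂ)) * (u j + Complex.I * x j) = 1 := by
    push_cast
    linear_combination h - (x j : ℂ) ^ 2 * Complex.I_sq
  rw [h1, one_pow]

theorem HasBranches.reflect {n : ℕ} {a b : ℝ} {Y : ℝ → Matrix (Fin n ⊕ Fin n) (Fin n) ℝ}
    (hY : IsLagrangianPath a b Y) {φ : Fin n → ℝ → ℝ}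
    (hφ : HasBranches (fun t => souriau (Y t)) φ a b) :
    HasBranches (fun t => souriau (LagrangianPath.reflect (Y t))) (fun j t => -φ j t) a b := by
  refine ⟨fun j => (hφ.1 j).neg, fun t ht => ?_⟩
  rw [(hY.2 t ht).roots_souriau_reflect, hφ.2 t ht, Multiset.map_map]
  refine Multiset.map_congr rfl fun j _ => ?_
  simp only [Function.comp_apply]
  rw [← Complex.exp_neg]
  congr 1
  push_cast
  ring

/-! ### Oscillation numbers and Lidskii angles -/

theorem isLidskiiBranches_iff {n : ℕ} {a b : ℝ} {Y : ℝ → Matrix (Fin n ⊕ Fin n) (Fin n) ℝ}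
    (hY : IsLagrangianPath a b Y) {φ : Fin n → ℝ → ℝ} :
    IsLidskiiBranches a b Y φ ↔ HasBranches (fun t => souriau (Y t)) φ a b := by
  refine and_congr_right fun _ => forall₂_congr fun t ht => ?_
  rw [IsLidskiiAngles, (hY.2 t ht).charpoly_lidskiiMatrix]

theorem IsLagrangianPath.mono {n : ℕ} {a b u v : ℝ} {Y : ℝ → Matrix (Fin n ⊕ Fin n) (Fin n) ℝ}
    (hY : IsLagrangianPath a b Y) (hau : a ≤ u) (hvb : v ≤ b) : IsLagrangianPath u v Y :=
  ⟨hY.1.mono (Set.Icc_subset_Icc hau hvb), fun t ht => hY.2 t (Set.Icc_subset_Icc hau hvb ht)⟩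

theorem compIndex_sub_eq {n : ℕ} {a b : ℝ} (hab : a < b)
    {Y Y' : ℝ → Matrix (Fin n ⊕ Fin n) (Fin n) ℝ}
    (hY : IsLagrangianPath a b Y) (hY' : IsLagrangianPath a b Y') {r r' : ℕ}
    (hr : ∀ t ∈ Set.Icc a b, (wronskian (Y t) (Y' t)).rank = r)
    (hr' : ∀ t ∈ Set.Icc a b, (upper (Y' t)).rank = r')
    {φ : Fin n → ℝ → ℝ} (hφ : HasBranches (fun t => souriau (Y t)) φ a b) :
    (compIndex (Y b) (Y' b) : ℤ) - compIndex (Y a) (Y' a)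
      = ∑ j, ⌊φ j b / (2 * Real.pi)⌋ - ∑ j, ⌊φ j a / (2 * Real.pi)⌋ := by
  have h := angleIndex_sub_sum_floor hab hY hY' hr hr' hφ
  rw [← compIndex_eq_angleIndex (hY.2 b ⟨hab.le, le_rfl⟩) (hY'.2 b ⟨hab.le, le_rfl⟩),
    ← compIndex_eq_angleIndex (hY.2 a ⟨le_rfl, hab.le⟩) (hY'.2 a ⟨le_rfl, hab.le⟩)] at h
  exact_mod_cast h

/-- This is `compIndex_sub_eq` for the reflected paths. The identity `⌊-s⌋ = -⌈s⌉` explains the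
ceilings and the reversed order of the endpoints. -/
theorem dualCompIndex_sub_eq {n : ℕ} {a b : ℝ} (hab : a < b)
    {Y Y' : ℝ → Matrix (Fin n ⊕ Fin n) (Fin n) ℝ}
    (hY : IsLagrangianPath a b Y) (hY' : IsLagrangianPath a b Y') {r r' : ℕ}
    (hr : ∀ t ∈ Set.Icc a b, (wronskian (Y t) (Y' t)).rank = r)
    (hr' : ∀ t ∈ Set.Icc a b, (upper (Y' t)).rank = r')
    {φ : Fin n → ℝ → ℝ} (hφ : HasBranches (fun t => souriau (Y t)) φ a b) :
    (dualCompIndex (Y a) (Y' a) : ℤ) - dualCompIndex (Y b) (Y' b)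
      = ∑ j, ⌈φ j b / (2 * Real.pi)⌉ - ∑ j, ⌈φ j a / (2 * Real.pi)⌉ := by
  have h := compIndex_sub_eq hab hY.reflect hY'.reflect (r := r) (r' := r')
    (fun t ht => by rw [wronskian_reflect, rank_neg, hr t ht])
    (fun t ht => by rw [upper_reflect, rank_neg, hr' t ht]) (hφ.reflect hY)
  simp only [compIndex_reflect, neg_div, Int.floor_neg, Finset.sum_neg_distrib] at h
  linarith

theorem sum_castSucc_sub {p : ℕ} (f : Fin (p + 1) → ℤ) :
    ∑ k : Fin p, (f k.succ - f k.castSucc) = f (Fin.last p) - f 0 := by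
  have h1 := Fin.sum_univ_succ f
  have h2 := Fin.sum_univ_castSucc f
  rw [Finset.sum_sub_distrib]
  linarith

theorem TransSystem.rank_wronskian {n : ℕ} {a b : ℝ}
    {Y : ℝ → Matrix (Fin n ⊕ Fin n) (Fin n) ℝ} (T : TransSystem a b Y) (k : Fin T.p) {s : ℝ}
    (hs : s ∈ Set.Icc a b) :
    (wronskian (Y s) (T.R k s * E n)).rank = (upper ((T.R k s)⁻¹ * Y s)).rank := by
  rw [upper_inv_mul (T.symplectic k s hs), rank_neg, ← Matrix.rank_transpose,
    wronskian_transpose, rank_neg]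

theorem TransSystem.mem_Icc {n : ℕ} {a b : ℝ} {Y : ℝ → Matrix (Fin n ⊕ Fin n) (Fin n) ℝ}
    (T : TransSystem a b Y) (k : Fin (T.p + 1)) : T.t k ∈ Set.Icc a b := by
  have h1 := T.strictMono.monotone (Fin.zero_le k)
  have h2 := T.strictMono.monotone (Fin.le_last k)
  rw [T.first] at h1
  rw [T.last] at h2
  exact ⟨h1, h2⟩

theorem TransSystem.isLagrangianPath {n : ℕ} {a b : ℝ}
    {Y : ℝ → Matrix (Fin n ⊕ Fin n) (Fin n) ℝ} (T : TransSystem a b Y) (k : Fin T.p) :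
    IsLagrangianPath (T.t k.castSucc) (T.t k.succ) fun s => T.R k s * E n :=
  ⟨((continuous_id.matrix_mul continuous_const).comp_continuousOn (T.continuousOn k) :),
    fun s hs => (isLagrangian_E n).symplectic_mul (T.symplectic k s
      ⟨(T.mem_Icc k.castSucc).1.trans hs.1, hs.2.trans (T.mem_Icc k.succ).2⟩)⟩

/-- The local identities telescope. The right sides do not involve the admissible pair, so
independence of it comes for free. -/
theorem TransSystem.oscSum_eq {n : ℕ} {a b : ℝ} {Y : ℝ → Matrix (Fin n ⊕ Fin n) (Fin n) ℝ}
    (hY : IsLagrangianPath a b Y) {φ : Fin n → ℝ → ℝ}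
    (hφ : HasBranches (fun t => souriau (Y t)) φ a b) (T : TransSystem a b Y) :
    T.oscSum = ∑ j, (⌊φ j b / (2 * Real.pi)⌋ - ⌊φ j a / (2 * Real.pi)⌋) ∧
      T.dualOscSum = ∑ j, (⌈φ j b / (2 * Real.pi)⌉ - ⌈φ j a / (2 * Real.pi)⌉) := by
  have hlt : ∀ k : Fin T.p, T.t k.castSucc < T.t k.succ := fun k =>
    T.strictMono Fin.castSucc_lt_succ
  have hl : ∀ k : Fin T.p, a ≤ T.t k.castSucc := fun k => (T.mem_Icc _).1
  have hr : ∀ k : Fin T.p, T.t k.succ ≤ b := fun k => (T.mem_Icc _).2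
  have hsub : ∀ (k : Fin T.p), ∀ s ∈ Set.Icc (T.t k.castSucc) (T.t k.succ), s ∈ Set.Icc a b :=
    fun k s hs => ⟨(hl k).trans hs.1, hs.2.trans (hr k)⟩
  rw [Finset.sum_sub_distrib, Finset.sum_sub_distrib]
  constructor
  · have h := sum_castSucc_sub fun k => ∑ j, ⌊φ j (T.t k) / (2 * Real.pi)⌋
    rw [T.first, T.last] at h
    rw [← h, TransSystem.oscSum]
    refine Finset.sum_congr rfl fun k _ => ?_
    obtain ⟨r, hrk⟩ := T.rank_transformed k
    obtain ⟨r', hrk'⟩ := T.rank_reference k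
    exact compIndex_sub_eq (hlt k) (hY.mono (hl k) (hr k)) (T.isLagrangianPath k)
      (fun s hs => (T.rank_wronskian k (hsub k s hs)).trans (hrk s hs)) hrk'
      (hφ.mono (hl k) (hr k))
  · have h := sum_castSucc_sub fun k => ∑ j, ⌈φ j (T.t k) / (2 * Real.pi)⌉
    rw [T.first, T.last] at h
    rw [← h, TransSystem.dualOscSum]
    refine Finset.sum_congr rfl fun k _ => ?_
    obtain ⟨r, hrk⟩ := T.rank_transformed k
    obtain ⟨r', hrk'⟩ := T.rank_reference k
    exact dualCompIndex_sub_eq (hlt k) (hY.mono (hl k) (hr k)) (T.isLagrangianPath k)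
      (fun s hs => (T.rank_wronskian k (hsub k s hs)).trans (hrk s hs)) hrk'
      (hφ.mono (hl k) (hr k))

/-- A number `c` with `cU - X` invertible at one point works nearby. On each piece take the constant
shear `R` with `R E = (cI, I)`: the Wronskian of `R E` and `Y` is `cU - X`, of rank `n`, and the
rank of the upper block of `R E` is trivially constant. -/
theorem nonempty_transSystem {n : ℕ} {a b : ℝ} (hab : a < b)
    {Y : ℝ → Matrix (Fin n ⊕ Fin n) (Fin n) ℝ} (hY : IsLagrangianPath a b Y) :
    Nonempty (TransSystem a b Y) := by
  have hloc : ∀ t ∈ Set.Icc a b, ∃ ε > 0, ∀ u ∈ Set.Icc a b, ∀ v ∈ Set.Icc a b, u ≤ v →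
      |u - t| < ε → |v - t| < ε →
      ∃ c : ℝ, ∀ s ∈ Set.Icc u v, IsUnit (c • lower (Y s) - upper (Y s)).det := by
    intro t ht
    obtain ⟨c, hc⟩ := (hY.2 t ht).exists_transversal
    have hcont : Continuous fun M : Matrix (Fin n ⊕ Fin n) (Fin n) ℝ =>
        (c • lower M - upper M).det := by
      refine Continuous.matrix_det (Continuous.sub (Continuous.const_smul ?_ c) ?_)
      · exact continuous_matrix fun i j => continuous_id.matrix_elem _ _
      · exact continuous_matrix fun i j => continuous_id.matrix_elem _ _
    have hev := (hcont.comp_continuousOn hY.1 t ht).eventually_ne hc.ne_zero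
    rw [eventually_nhdsWithin_iff, Metric.eventually_nhds_iff] at hev
    obtain ⟨ε, hε, hev⟩ := hev
    refine ⟨ε, hε, fun u hu v hv huv hut hvt => ⟨c, fun s hs => ?_⟩⟩
    refine isUnit_iff_ne_zero.mpr (hev ?_ ⟨hu.1.trans hs.1, hs.2.trans hv.2⟩)
    rw [Real.dist_eq]
    exact abs_lt.mpr ⟨by linarith [(abs_lt.mp hut).1, hs.1], by linarith [(abs_lt.mp hvt).2, hs.2]⟩
  obtain ⟨N, hN, hP⟩ := exists_equipartition hab hloc
  choose c hc using hP
  have hN0 : (0 : ℝ) < N := by exact_mod_cast hN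
  have hstep : 0 < (b - a) / N := div_pos (sub_pos.mpr hab) hN0
  have hQ : ∀ r : ℝ, (r • (1 : Matrix (Fin n) (Fin n) ℝ))ᵀ = r • 1 := fun r => by
    rw [Matrix.transpose_smul, Matrix.transpose_one]
  refine ⟨{ p := N
            t := fun k => a + (k : ℕ) * ((b - a) / N)
            R := fun k _ => hShear (c k k.2 • 1)
            strictMono := ?_
            first := by simp
            last := ?_
            symplectic := fun k s _ => hShear_mem (hQ _)
            continuousOn := fun k => continuousOn_const
            rank_transformed := fun k => ⟨n, fun s hs => ?_⟩
            rank_reference := fun k => ⟨_, fun s _ => rfl⟩ }⟩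
  · intro k l hkl
    have : ((k : ℕ) : ℝ) < (l : ℕ) := by exact_mod_cast hkl
    simp only
    nlinarith
  · simp only [Fin.val_last]
    field_simp
    ring
  · have hE : hShear (c k k.2 • (1 : Matrix (Fin n) (Fin n) ℝ)) * E n
        = Matrix.fromRows (c k k.2 • 1) 1 := by
      rw [hShear, E, Matrix.fromBlocks_mul_fromRows]
      simp
    rw [upper_inv_mul (hShear_mem (hQ _)), rank_neg, hE, wronskian_eq, upper_fromRows,
      lower_fromRows, hQ, Matrix.transpose_one, Matrix.one_mul, Matrix.smul_mul, Matrix.one_mul,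
      rank_eq_iff_isUnit_det]
    refine hc k k.2 s ?_
    simpa using hs

end LagrangianPath

/-! ### The main theorem -/

theorem theoremT (n : ℕ) (a b : ℝ) (hab : a < b)
    (Y : ℝ → Matrix (Fin n ⊕ Fin n) (Fin n) ℝ)
    (hY : LagrangianPath.IsLagrangianPath a b Y) :
    -- continuous branches of the Lidskii angles and admissible pairs `(D, R)` exist
    (∃ φ : Fin n → ℝ → ℝ, LagrangianPath.IsLidskiiBranches a b Y φ) ∧
    Nonempty (LagrangianPath.TransSystem a b Y) ∧
    -- the oscillation numbers do not depend on the choice of `(D, R)`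
    (∀ T : LagrangianPath.TransSystem a b Y,
      T.oscSum = LagrangianPath.oscNumber a b Y ∧
      T.dualOscSum = LagrangianPath.dualOscNumber a b Y) ∧
    -- the formulas, for arbitrary continuous branches of the Lidskii angles
    (∀ φ : Fin n → ℝ → ℝ, LagrangianPath.IsLidskiiBranches a b Y φ →
      LagrangianPath.oscNumber a b Y =
        ∑ j : Fin n, (⌊φ j b / (2 * Real.pi)⌋ - ⌊φ j a / (2 * Real.pi)⌋) ∧
      LagrangianPath.dualOscNumber a b Y =
        ∑ j : Fin n, ((⌈φ j b / (2 * Real.pi)⌉ - 1) - (⌈φ j a / (2 * Real.pi)⌉ - 1))) := by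
  have hbr := fun φ => LagrangianPath.isLidskiiBranches_iff hY (φ := φ)
  have hT := LagrangianPath.nonempty_transSystem hab hY
  obtain ⟨φ₀, hφ₀⟩ := LagrangianPath.exists_branches hab hY.continuousOn_souriau
    fun t ht => (hY.2 t ht).norm_of_mem_roots
  have hosc : LagrangianPath.oscNumber a b Y = hT.some.oscSum := dif_pos hT
  have hdual : LagrangianPath.dualOscNumber a b Y = hT.some.dualOscSum := dif_pos hT
  refine ⟨⟨φ₀, (hbr φ₀).mpr hφ₀⟩, hT, fun T => ?_, fun φ hφ => ?_⟩
  · obtain ⟨h1, h2⟩ := T.oscSum_eq hY hφ₀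
    obtain ⟨h3, h4⟩ := hT.some.oscSum_eq hY hφ₀
    rw [hosc, hdual, h1, h2, h3, h4]
    exact ⟨rfl, rfl⟩
  · obtain ⟨h3, h4⟩ := hT.some.oscSum_eq hY ((hbr φ).mp hφ)
    rw [hosc, hdual, h3, h4]
    -- The shifts by `-1` in `q_j*` cancel in the difference.
    exact ⟨rfl, Finset.sum_congr rfl fun j _ => by ring⟩
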